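/- Let $d,k\ge 1$. Let $\Omega\subset\mathbb R^d$ be open, with $\partial\Omega$ of finite $(d-1)$-dimensional surface measure and with an outward unit normal $n$ almost everywhere on $\partial\Omega$; let $\partial\Omega_D\subseteq\partial\Omega$ be measurable. Let $\Omega$ be covered by an ambient mesh of finitely many closed axis-parallel boxes with pairwise disjoint interiors. Put $\mathcal T=\{K: K\cap\Omega\ne\emptyset\}$ (also written for the union of these elements), $\mathcal G=\{K\in\mathcal T: K\cap\partial\Omega\neq\emptyset\}$ (cut elements), $h_K=\mathrm{meas}(K)^{1/d}$, $E_K=\partial(K\cap\Omega)\cap\partial\Omega$ (assumed to overlap only in null sets) and $E_K^D=E_K\cap\partial\Omega_D$; $\mathcal F_{\rm ghost}$ is the set of interfaces $F=\partial K\cap\partial K'$ with $K\in\mathcal G$, $K'\in\mathcal T$, $K\ne K'$, and $h_F=\max(h_K,h_{K'})$. Let $Q_k$ be the polynomials of degree at most $k$ in each variable and $U^h=\{u\in C^{k-1}(\mathcal T): u|_K\in Q_k\ \forall K\in\mathcal T\}$. Let $[\![\partial_n^k u]\!]$ be the jump over an interface of the $k$-th derivative in its normal direction. On $E_K$, $\partial_n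 u=\nabla (u|_K)\cdot n$. For $\tilde\beta>0$ constant on each element and $\tilde\gamma_g\ge 0$ constant on each interface put $$a^h(u,v)=\int_\Omega\nabla u\cdot\nabla v-\sum_{K\in\mathcal T}\int_{E_K^D}(\partial_n u\,v+u\,\partial_n v)\,dS+\sum_{K\in\mathcal T}\int_{E_K^D}\tilde\beta uv\,dS+\sum_{F\in\mathcal F_{\rm ghost}}\int_F\tilde\gamma_g[\![\partial_n^k u]\!][\![\partial_n^k v]\!]\,dS,$$ $$|||u|||^2=\|\nabla u\|_{L^2(\mathcal T)}^2+\|\tilde\beta^{-1/2}\partial_n u\|_{L^2(\partial\Omega_D)}^2+\|\tilde\beta^{1/2}u\|_{L^2(\partial\Omega_D)}^2+\sum_{F\in\mathcal F_{\rm ghost}}\|\tilde\gamma_g^{1/2}[\![\partial_n^k u]\!]\|_{L^2(F)}^2 .$$ Call $C_T$ a trace constant of the mesh if $\|\phi\|^2_{L^2(E_K)}\le C_T\|h_K^{-1/2}\phi\|^2_{L^2(K)}$ for all $K\in\mathcal G$, $\phi\in Q_k$, and $(C_G,C_F)$ ghost constants of the mesh if $\|\nabla u\|^2_{L^2(\mathcal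 T)}\le C_G\|\nabla u\|^2_{L^2(\Omega)}+\sum_{F\in\mathcal F_{\rm ghost}}C_Fh_F^{2k-1}\|[\![\partial_n^k u]\!]\|^2_{L^2(F)}$ for all $u\in U^h$. Call two distinct elements of $\mathcal T$ adjacent if their interface has positive surface measure. Call the mesh $\sigma$-quasi-uniform if every edge of every $K\in\mathcal T$ has length at most $\sigma h_K$ and $h_K\le\sigma h_{K'}$ for adjacent $K,K'$. Call it $(s,\sigma,N)$-regular if, in addition, $\min(h_K,h_{K'})^{d-1}\le\sigma\,\mathrm{meas}(F)$ for the interface $F$ of adjacent $K,K'$, $\mathrm{meas}(E_K)\le s\,h_K^{d-1}$ for $K\in\mathcal G$, and every $K\in\mathcal T$ is reached from some element of $\mathcal T\setminus\mathcal G$ through at most $N$ successive interfaces between adjacent elements. Then: 1. (Continuity.) For all such $\tilde\beta>0$, $\tilde\gamma_g\ge0$ and all $u,v\in U^h$: $a^h(u,v)\le 5\,|||u|||\,|||v|||$. 2. (Uniform coercivity on regular meshes.) For every $s$ there is $C_T>0$, depending only on $d,k,s$, and for all $\sigma,N$ there are $C_G,C_F>0$, depending only on $d,k,s,\sigma,N$,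 such that $C_T$ is a trace constant and $(C_G,C_F)$ are ghost constants of every $(s,\sigma,N)$-regular mesh, and such that for all $\beta\ge C_TC_G$ and $\gamma_g\ge C_F/C_G$ there is $c>0$ with $$a^h(u,u)\ge c\,|||u|||^2\quad\text{for all }u\in U^h,\qquad \tilde\beta=\beta h_K^{-1},\ \tilde\gamma_g=\gamma_gh_F^{2k-1},$$ on every $(s,\sigma,N)$-regular mesh; $c$ does not depend on the mesh size, on $\Omega$ or on how elements are cut. 3. (Uniform coercivity for arbitrary constants.) For all $\sigma$, all $C_T,C_G,C_F>0$ and all $\beta>C_TC_G$, $\gamma_g\ge C_F/C_G$ there is $c>0$ such that the same inequality holds on every $\sigma$-quasi-uniform mesh for which $C_T$ is a trace constant and $(C_G,C_F)$ are ghost constants. -/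

import Mathlib

open MeasureTheory

noncomputable section

/-- `(d-1)`-dimensional surface measure on `ℝ^d` (for `d = 1`: counting measure). -/
abbrev surfaceMeasure (d : ℕ) : Measure (EuclideanSpace ℝ (Fin d)) := μHE[d - 1]

/-- The closed axis-parallel box in `ℝ^d` with the corners of `I`. -/
def closedBox {d : ℕ} (I : BoxIntegral.Box (Fin d)) : Set (EuclideanSpace ℝ (Fin d)) :=
  {x | ∀ a, x a ∈ Set.Icc (I.lower a) (I.upper a)}

/-- `ν` is the outward unit normal of `Ω` at `x`: near `x`, up to a cone of arbitrarily small
opening around the hyperplane through `x` orthogonal to `ν`, the set `Ω` is the half-space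
opposite to `ν`. There is at most one such `ν`. -/
def IsOutwardUnitNormal {d : ℕ} (Ω : Set (EuclideanSpace ℝ (Fin d)))
    (x ν : EuclideanSpace ℝ (Fin d)) : Prop :=
  ‖ν‖ = 1 ∧ ∀ ε > 0, ∃ r > 0, ∀ y, ‖y - x‖ < r →
    (y ∈ Ω → inner ℝ (y - x) ν ≤ ε * ‖y - x‖) ∧
    (y ∉ Ω → -(ε * ‖y - x‖) ≤ inner ℝ (y - x) ν)

/-- The piece of `∂Ω` that belongs to the boundary of the cut element `K ∩ Ω`. -/
def cutFace {d : ℕ} (Ω K : Set (EuclideanSpace ℝ (Fin d))) : Set (EuclideanSpace ℝ (Fin d)) :=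
  frontier (K ∩ Ω) ∩ frontier Ω

/-- A physical domain `Ω` with Dirichlet boundary `ΓD`, immersed in an ambient mesh of finitely
many axis-parallel boxes with pairwise disjoint interiors. -/
structure ImmersedMesh (d : ℕ) where
  Ω : Set (EuclideanSpace ℝ (Fin d))
  isOpen_Ω : IsOpen Ω
  surface_lt_top : surfaceMeasure d (frontier Ω) < ⊤
  /-- The outward unit normal on `∂Ω`, which exists almost everywhere. -/
  normal : EuclideanSpace ℝ (Fin d) → EuclideanSpace ℝ (Fin d)
  measurable_normal : Measurable normal
  normal_spec : ∀ᵐ x ∂((surfaceMeasure d).restrict (frontier Ω)),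
    IsOutwardUnitNormal Ω x (normal x)
  /-- The Dirichlet part of the boundary. -/
  ΓD : Set (EuclideanSpace ℝ (Fin d))
  measurableSet_ΓD : MeasurableSet ΓD
  ΓD_subset : ΓD ⊆ frontier Ω
  /-- The number of elements of the ambient mesh. -/
  n : ℕ
  elem : Fin n → BoxIntegral.Box (Fin d)
  disjoint_elem : ∀ i j, i ≠ j →
    Disjoint (interior (closedBox (elem i))) (interior (closedBox (elem j)))
  subset_ambient : Ω ⊆ ⋃ i, closedBox (elem i)
  /-- The faces of the boundary mesh overlap in null sets only. -/
  disjoint_cutFace : ∀ i j, i ≠ j →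
    surfaceMeasure d (cutFace Ω (closedBox (elem i)) ∩ cutFace Ω (closedBox (elem j))) = 0

namespace ImmersedMesh

variable {d : ℕ} (D : ImmersedMesh d)

/-- The closed element with index `i`. -/
def cell (i : Fin D.n) : Set (EuclideanSpace ℝ (Fin d)) := closedBox (D.elem i)

open Classical in
/-- The background mesh `𝒯`: the elements that intersect `Ω`. -/
def active : Finset (Fin D.n) := Finset.univ.filter fun i => (D.cell i ∩ D.Ω).Nonempty

/-- The geometry of the background mesh, the union of its elements. -/
def region : Set (EuclideanSpace ℝ (Fin d)) := ⋃ i ∈ D.active, D.cell i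

/-- The mesh size `h_K = meas(K)^{1/d}`. -/
def meshSize (i : Fin D.n) : ℝ := (volume.real (D.cell i)) ^ ((1 : ℝ) / (d : ℝ))

/-- Membership in `𝒢`: background elements crossed by `∂Ω`. -/
def IsCut (i : Fin D.n) : Prop := i ∈ D.active ∧ (D.cell i ∩ frontier D.Ω).Nonempty

/-- The boundary face `E` of the cut element `K ∩ Ω`. -/
def face (i : Fin D.n) : Set (EuclideanSpace ℝ (Fin d)) := cutFace D.Ω (D.cell i)

/-- The Dirichlet part of the boundary face of the element `i`. -/
def dirichletFace (i : Fin D.n) : Set (EuclideanSpace ℝ (Fin d)) := D.face i ∩ D.ΓD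

/-- The interface `F = ∂K ∩ ∂K'` of two elements. -/
def interface (i j : Fin D.n) : Set (EuclideanSpace ℝ (Fin d)) :=
  frontier (D.cell i) ∩ frontier (D.cell j)

/-- The interface length scale `h_F = max (h_K, h_{K'})`. -/
def interfaceSize (i j : Fin D.n) : ℝ := max (D.meshSize i) (D.meshSize j)

open Classical in
/-- The ghost mesh: interfaces of two distinct background elements at least one of which is cut.
Every unordered pair `{K, K'}` is listed once, as `(i, j)` with `i < j`. Pairs whose intersection
is empty or of dimension less than `d - 1` are harmless, since all integrals over them vanish. -/
def ghost : Finset (Fin D.n × Fin D.n) :=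
  (D.active ×ˢ D.active).filter fun p => p.1 < p.2 ∧ (D.IsCut p.1 ∨ D.IsCut p.2)

open Classical in
/-- A unit normal of the interface of two elements: the coordinate direction in which the two
boxes are adjacent. It is unique up to sign whenever the interface has positive surface measure,
and its value is irrelevant otherwise. -/
def interfaceNormal (i j : Fin D.n) : EuclideanSpace ℝ (Fin d) :=
  if h : ∃ a, (D.elem i).upper a = (D.elem j).lower a ∨ (D.elem j).upper a = (D.elem i).lower a
  then EuclideanSpace.single h.choose 1 else 0

/-- The jump `⟦∂_n^k u⟧` of the `k`-th normal derivative over the interface of two elements, as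
the difference of the one-sided derivatives. -/
def jump (k : ℕ) (u : EuclideanSpace ℝ (Fin d) → ℝ) (i j : Fin D.n)
    (x : EuclideanSpace ℝ (Fin d)) : ℝ :=
  iteratedFDerivWithin ℝ k u (D.cell i) x (fun _ => D.interfaceNormal i j) -
    iteratedFDerivWithin ℝ k u (D.cell j) x (fun _ => D.interfaceNormal i j)

/-- The normal derivative `∂_n u = ∇u · n` on `∂Ω`, with the gradient taken from within the
element `i`. -/
def normalDeriv (u : EuclideanSpace ℝ (Fin d) → ℝ) (i : Fin D.n)
    (x : EuclideanSpace ℝ (Fin d)) : ℝ :=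
  inner ℝ (gradientWithin u (D.cell i) x) (D.normal x)

/-- The spline space of degree `k` and maximal regularity: functions of class `C^{k-1}` on the
background mesh whose restriction to each element is a tensor-product polynomial of degree at
most `k` in each variable. Values outside the background mesh play no role. -/
def splineSpace (k : ℕ) : Set (EuclideanSpace ℝ (Fin d) → ℝ) :=
  {u | ContDiffOn ℝ ((k - 1 : ℕ) : WithTop ℕ∞) u D.region ∧
    ∀ i ∈ D.active, ∃ p ∈ MvPolynomial.restrictDegree (Fin d) ℝ k,
      ∀ x ∈ D.cell i, u x = MvPolynomial.eval (fun a => x a) p}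

/-- The Nitsche bilinear form with ghost penalty, for a Nitsche parameter that is constant on
each element and a ghost parameter that is constant on each interface. -/
def form (k : ℕ) (βt : Fin D.n → ℝ) (γt : Fin D.n → Fin D.n → ℝ)
    (u v : EuclideanSpace ℝ (Fin d) → ℝ) : ℝ :=
  (∫ x in D.Ω, inner ℝ (gradient u x) (gradient v x))
  - (∑ i ∈ D.active, ∫ x in D.dirichletFace i,
      (D.normalDeriv u i x * v x + u x * D.normalDeriv v i x) ∂(surfaceMeasure d))
  + (∑ i ∈ D.active, ∫ x in D.dirichletFace i, βt i * (u x * v x) ∂(surfaceMeasure d))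
  + ∑ p ∈ D.ghost, ∫ x in D.interface p.1 p.2,
      γt p.1 p.2 * (D.jump k u p.1 p.2 x * D.jump k v p.1 p.2 x) ∂(surfaceMeasure d)

/-- The energy norm. -/
def energyNorm (k : ℕ) (βt : Fin D.n → ℝ) (γt : Fin D.n → Fin D.n → ℝ)
    (u : EuclideanSpace ℝ (Fin d) → ℝ) : ℝ :=
  Real.sqrt ((∫ x in D.region, ‖gradient u x‖ ^ 2)
    + (∑ i ∈ D.active, ∫ x in D.dirichletFace i,
        (βt i)⁻¹ * D.normalDeriv u i x ^ 2 ∂(surfaceMeasure d))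
    + (∑ i ∈ D.active, ∫ x in D.dirichletFace i, βt i * u x ^ 2 ∂(surfaceMeasure d))
    + ∑ p ∈ D.ghost, ∫ x in D.interface p.1 p.2,
        γt p.1 p.2 * D.jump k u p.1 p.2 x ^ 2 ∂(surfaceMeasure d))

/-- The Nitsche parameter `β h_K⁻¹`. -/
def nitscheParam (β : ℝ) (i : Fin D.n) : ℝ := β * (D.meshSize i)⁻¹

/-- The ghost parameter `γ h_F^{2k-1}`. -/
def ghostParam (k : ℕ) (γ : ℝ) (i j : Fin D.n) : ℝ := γ * D.interfaceSize i j ^ (2 * k - 1)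

/-- `CT` is a trace constant: `‖φ‖²_{L²(E)} ≤ CT ‖h_K^{-1/2} φ‖²_{L²(K)}` for every cut
background element `K` with boundary face `E` and every tensor-product polynomial `φ` of degree
at most `k`. -/
def IsTraceConst (k : ℕ) (CT : ℝ) : Prop :=
  ∀ i, D.IsCut i → ∀ φ ∈ MvPolynomial.restrictDegree (Fin d) ℝ k,
    ∫ x in D.face i, MvPolynomial.eval (fun a => x a) φ ^ 2 ∂(surfaceMeasure d) ≤
      CT * ∫ x in D.cell i, (D.meshSize i)⁻¹ * MvPolynomial.eval (fun a => x a) φ ^ 2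

/-- `CG` and `CF` are ghost-penalty constants: they bound the gradient on the whole background
mesh by the gradient on `Ω` and the scaled jumps over the ghost mesh. -/
def IsGhostConst (k : ℕ) (CG CF : ℝ) : Prop :=
  ∀ u ∈ D.splineSpace k,
    ∫ x in D.region, ‖gradient u x‖ ^ 2 ≤
      CG * (∫ x in D.Ω, ‖gradient u x‖ ^ 2) +
        ∑ p ∈ D.ghost, CF * D.interfaceSize p.1 p.2 ^ (2 * k - 1) *
          ∫ x in D.interface p.1 p.2, D.jump k u p.1 p.2 x ^ 2 ∂(surfaceMeasure d)

/-- Two distinct background elements that share an interface of positive surface measure. -/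
def Adjacent (i j : Fin D.n) : Prop :=
  i ∈ D.active ∧ j ∈ D.active ∧ i ≠ j ∧ surfaceMeasure d (D.interface i j) ≠ 0

/-- The background elements have bounded aspect ratio, and adjacent ones have comparable size. -/
structure IsQuasiUniform (σ : ℝ) : Prop where
  aspect : ∀ i ∈ D.active, ∀ a, (D.elem i).upper a - (D.elem i).lower a ≤ σ * D.meshSize i
  grading : ∀ i j, D.Adjacent i j → D.meshSize i ≤ σ * D.meshSize j

/-- The background elements that can be reached through at most `m` interfaces from an uncut
background element. -/
def Reachable : ℕ → Fin D.n → Prop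
  | 0, i => i ∈ D.active ∧ ¬ D.IsCut i
  | m + 1, i => Reachable m i ∨ ∃ j, Reachable m j ∧ D.Adjacent i j

/-- Shape regularity of the mesh and of its cut: besides `IsQuasiUniform`, an interface is
comparable with a full face of the smaller one of its two elements, the boundary piece in a cut
element is bounded, and the cut elements form at most `N` layers around uncut ones. -/
structure IsRegular (s σ : ℝ) (N : ℕ) : Prop extends D.IsQuasiUniform σ where
  interface_large : ∀ i j, D.Adjacent i j →
    min (D.meshSize i) (D.meshSize j) ^ (d - 1) ≤ σ * (surfaceMeasure d).real (D.interface i j)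
  face_bound : ∀ i, D.IsCut i → (surfaceMeasure d).real (D.face i) ≤ s * D.meshSize i ^ (d - 1)
  layers : ∀ i ∈ D.active, D.Reachable N i

end ImmersedMesh

end

/-! ### Norm equivalence on `Q_k` and stability under substitution -/

open MvPolynomial

/-! Continuity is the Cauchy–Schwarz inequality applied to five products: the gradients, the two
flux–trace terms, the penalty term and the jumps. Each is at most a product of energy norms, whence
the constant 5.

For coercivity write `O`, `A` for the squared gradient norms on the domain and on the background
mesh, `N`, `B` for the weighted flux and trace on the Dirichlet boundary, and `G` for the ghost
term. Then `a(u,u) ≥ O - 2√N√B + B + G`. The trace inequality, applied to every partial derivative,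
gives `N ≤ (CT/β) A`, and the ghost inequality together with `CF/γ ≤ CG` gives `A ≤ CG (O + G)`.
Young's inequality weighted by some `δ` strictly between `CT CG` and `β` absorbs the cross term
(`exists_coercive`).

The uniform constants rest on finite-dimensional norm equivalence: on a box, values and scaled
derivatives of a polynomial in `Q_k` are bounded by its `L²` mean, even at points a bounded number
of edge lengths away. Each axis is rescaled separately, so the aspect ratio does not enter. Together
with the bound on the boundary pieces this is already the trace inequality.

The ghost inequality propagates the gradient from uncut elements, which lie inside the domain,
through the layers of cut ones. On two adjacent elements the polynomial pieces differ by a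
polynomial `w` whose normal derivatives of order below `k` vanish on the interface, while its degree
in the normal variable is at most `k`. Hence `w` is exactly `(x_a - c)^k / k!` times the jump of the
`k`-th normal derivative (`IsPiecewise.polyFun_sub_eq`), and an inverse estimate bounds its gradient
by the ghost penalty. Each layer costs a bounded factor because a volume count bounds the number of
neighbours. -/

theorem MvPolynomial.exists_sq_eval_le_integral_unitCube (d k : ℕ) (R : ℝ) :
    ∃ C > 0, ∀ p ∈ restrictDegree (Fin d) ℝ k, ∀ x : Fin d → ℝ, (∀ b, |x b| ≤ R) →
      eval x p ^ 2 ≤ C * ∫ y in Set.Icc (0 : Fin d → ℝ) 1, eval y p ^ 2 ∧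
      ∀ b, eval x (pderiv b p) ^ 2 ≤ C * ∫ y in Set.Icc (0 : Fin d → ℝ) 1, eval y p ^ 2 := by
  classical
  let V := restrictDegree (Fin d) ℝ k
  let m := Module.finrank ℝ V
  let e : Module.Basis (Fin m) ℝ V := Module.finBasis ℝ V
  let P : (Fin m → ℝ) → MvPolynomial (Fin d) ℝ := fun c => ∑ i, c i • (e i : MvPolynomial (Fin d) ℝ)
  have hev : ∀ c x, eval x (P c) = ∑ i, c i * eval x (e i : MvPolynomial (Fin d) ℝ) := by
    intro c x; simp [P, smul_eval]
  have hpd : ∀ c x b, eval x (pderiv b (P c)) =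
      ∑ i, c i * eval x (pderiv b (e i : MvPolynomial (Fin d) ℝ)) := by
    intro c x b; simp [P, smul_eval]
  have hP : ∀ p ∈ V, ∃ c, P c = p := by
    intro p hp
    refine ⟨fun i => e.repr ⟨p, hp⟩ i, ?_⟩
    have h1 := congrArg (Submodule.subtype V) (e.sum_repr ⟨p, hp⟩)
    rw [map_sum] at h1
    exact h1
  have hinj : ∀ c, P c = 0 → c = 0 := by
    intro c hc
    have h1 : ∑ i, c i • e i = 0 := by
      apply Subtype.ext
      simpa [P] using hc
    exact _root_.funext fun i => (Fintype.linearIndependent_iff.1 e.linearIndependent) c h1 i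
  have hsmul : ∀ (r : ℝ) c, P (r • c) = r • P c := by
    intro r c; simp [P, Finset.smul_sum, mul_smul]
  have hint : ∀ q : MvPolynomial (Fin d) ℝ, IntegrableOn (fun y => eval y q) (Set.Icc 0 1) := fun q =>
    (MvPolynomial.continuous_eval q).continuousOn.integrableOn_compact isCompact_Icc
  let f : (Fin m → ℝ) → ℝ := fun c => ∫ y in Set.Icc (0 : Fin d → ℝ) 1, eval y (P c) ^ 2
  -- In coefficients the squared `L²` norm is a quadratic form given by the Gram matrix, which makes
  -- its continuity evident.
  have hf : ∀ c, f c = ∑ i, ∑ j, c i * c j *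
      ∫ y in Set.Icc (0 : Fin d → ℝ) 1, eval y ((e i : MvPolynomial (Fin d) ℝ) * e j) := by
    intro c
    have hI : ∀ i j, IntegrableOn (fun y => c i * eval y (e i : MvPolynomial (Fin d) ℝ) *
        (c j * eval y (e j : MvPolynomial (Fin d) ℝ))) (Set.Icc 0 1) := fun i j => by
      refine ((hint ((e i : MvPolynomial (Fin d) ℝ) * e j)).const_mul (c i * c j)).congr
        (.of_forall fun y => ?_)
      simp only [map_mul]; ring
    simp only [f, hev, sq, Finset.sum_mul_sum, ← integral_const_mul]
    rw [integral_finsetSum _ fun i _ => integrable_finsetSum _ fun j _ => hI i j]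
    refine Finset.sum_congr rfl fun i _ => ?_
    rw [integral_finsetSum _ fun j _ => hI i j]
    refine Finset.sum_congr rfl fun j _ => integral_congr_ae (.of_forall fun y => ?_)
    simp only [map_mul]; ring
  have hfc : Continuous f := by
    rw [_root_.funext hf]; fun_prop
  -- Definiteness: a vanishing integral forces the polynomial to vanish on the open cube, a product
  -- of infinite sets, and hence identically.
  have hpos : ∀ c, c ≠ 0 → 0 < f c := by
    intro c hc
    have h0 : 0 ≤ f c := integral_nonneg fun y => sq_nonneg _
    refine h0.lt_of_ne fun h => hc (hinj c ?_)
    have hcont : Continuous fun y => eval y (P c) ^ 2 := (MvPolynomial.continuous_eval _).pow 2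
    have h1 := (setIntegral_eq_zero_iff_of_nonneg_ae (.of_forall fun y => sq_nonneg _)
      (hcont.continuousOn.integrableOn_compact isCompact_Icc)).1 h.symm
    have h2 : (fun y => eval y (P c) ^ 2) =ᵐ[volume.restrict
        (interior (Set.Icc (0 : Fin d → ℝ) 1))] 0 :=
      ae_restrict_of_ae_restrict_of_subset interior_subset h1
    have h3 := Measure.eqOn_open_of_ae_eq h2 isOpen_interior hcont.continuousOn
      continuousOn_const
    refine MvPolynomial.funext_set (fun _ => Set.Ioo (0 : ℝ) 1) (fun _ => Set.Ioo_infinite one_pos) ?_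
    intro x hx
    have : x ∈ interior (Set.Icc (0 : Fin d → ℝ) 1) := by
      rw [← Set.pi_univ_Icc, interior_pi_set Set.finite_univ]
      simpa using hx
    simpa using h3 this
  let G : (Fin m → ℝ) × (Fin d → ℝ) → ℝ := fun z => eval z.2 (P z.1) ^ 2 +
    ∑ b, eval z.2 (pderiv b (P z.1)) ^ 2
  have hG : Continuous G := by
    simp only [G, hev, hpd]
    have := fun q : MvPolynomial (Fin d) ℝ => MvPolynomial.continuous_eval q
    fun_prop
  have hS : IsCompact ((Metric.sphere (0 : Fin m → ℝ) 1)) := isCompact_sphere _ _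
  have hX : IsCompact (Set.Icc (fun _ => -R) (fun _ => R) : Set (Fin d → ℝ)) := isCompact_Icc
  obtain ⟨B, hB⟩ := (hS.prod hX).bddAbove_image hG.continuousOn
  obtain ⟨μ, hμ, hμf⟩ : ∃ μ > 0, ∀ c ∈ Metric.sphere (0 : Fin m → ℝ) 1, μ ≤ f c := by
    rcases (Metric.sphere (0 : Fin m → ℝ) 1).eq_empty_or_nonempty with h | h
    · exact ⟨1, one_pos, by simp [h]⟩
    · obtain ⟨c, hc, hmin⟩ := hS.exists_isMinOn h hfc.continuousOn
      refine ⟨f c, hpos c ?_, fun c' hc' => hmin hc'⟩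
      rintro rfl; simp at hc
  -- Both sides are homogeneous of degree two in the coefficients, so the ratio of the maximum of
  -- `G` to the minimum of `f` on the unit sphere suffices; the `max` with 1 only secures
  -- positivity.
  refine ⟨max B 1 / μ, by positivity, ?_⟩
  intro p hp x hx
  obtain ⟨c, rfl⟩ := hP p hp
  have key : G (c, x) ≤ max B 1 / μ * f c := by
    rcases eq_or_ne c 0 with rfl | hc
    · simp [G, f, hev, hpd]
    · have hn : 0 < ‖c‖ := norm_pos_iff.2 hc
      let c' := ‖c‖⁻¹ • c
      have hc' : c' ∈ Metric.sphere (0 : Fin m → ℝ) 1 := by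
        simp [c', norm_smul, hn.ne']
      have hcc : c = ‖c‖ • c' := by simp [c', smul_smul, hn.ne']
      have h1 : G (c', x) ≤ B := hB ⟨(c', x), ⟨hc', by
        constructor <;> intro b <;> [exact (abs_le.1 (hx b)).1; exact (abs_le.1 (hx b)).2]⟩, rfl⟩
      have h2 := hμf c' hc'
      have h3 : G (c, x) = ‖c‖ ^ 2 * G (c', x) := by
        rw [hcc]
        simp only [G, hsmul, norm_smul, norm_norm, smul_eval, mul_pow,
          Finset.mul_sum, mul_add]
        simp [mem_sphere_zero_iff_norm.1 hc', mul_pow]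
      have h4 : f c = ‖c‖ ^ 2 * f c' := by
        rw [hcc]
        simp only [f, hsmul, smul_eval, mul_pow, integral_const_mul, norm_smul, norm_norm]
        simp [mem_sphere_zero_iff_norm.1 hc']
      rw [h3, h4]
      have : G (c', x) ≤ max B 1 / μ * f c' := by
        calc G (c', x) ≤ max B 1 := h1.trans (le_max_left _ _)
          _ = max B 1 / μ * μ := by field_simp
          _ ≤ _ := by gcongr
      calc _ ≤ ‖c‖ ^ 2 * (max B 1 / μ * f c') := by gcongr
        _ = _ := by ring
  have hs : ∀ b, 0 ≤ eval x (pderiv b (P c)) ^ 2 := fun b => sq_nonneg _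
  refine ⟨le_trans ?_ key, fun b => le_trans ?_ key⟩
  · exact le_add_of_nonneg_right (Finset.sum_nonneg fun b _ => hs b)
  · exact (Finset.single_le_sum (fun b _ => hs b) (Finset.mem_univ b)).trans
      (le_add_of_nonneg_left (sq_nonneg _))

theorem MvPolynomial.mem_restrictDegree_iff_degreeOf {σ : Type*} {k : ℕ} {p : MvPolynomial σ ℝ} :
    p ∈ restrictDegree σ ℝ k ↔ ∀ i, degreeOf i p ≤ k := by
  simp only [mem_restrictDegree, degreeOf_le_iff]
  exact ⟨fun h i m hm => h m hm i, fun h m hm i => h i m hm⟩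

/-- Substituting polynomials such that every variable occurs in total with degree at most one
does not raise the degrees in the individual variables. -/
theorem MvPolynomial.aeval_mem_restrictDegree {σ τ : Type*} [Fintype σ] {k : ℕ}
    {g : σ → MvPolynomial τ ℝ} (hg : ∀ t, ∑ s, degreeOf t (g s) ≤ 1)
    {p : MvPolynomial σ ℝ} (hp : p ∈ restrictDegree σ ℝ k) :
    aeval g p ∈ restrictDegree τ ℝ k := by
  rw [mem_restrictDegree_iff_degreeOf]
  intro t
  rw [aeval_def, eval₂_eq']
  refine (degreeOf_sum_le _ _ _).trans (Finset.sup_le fun m hm => ?_)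
  refine (degreeOf_C_mul_le _ _ _).trans ((degreeOf_prod_le _ _ _).trans ?_)
  calc ∑ s, degreeOf t (g s ^ m s) ≤ ∑ s, k * degreeOf t (g s) := by
        refine Finset.sum_le_sum fun s _ => (degreeOf_pow_le _ _ _).trans ?_
        exact Nat.mul_le_mul_right _ ((mem_restrictDegree _ _ _).1 hp m hm s)
    _ ≤ k * 1 := by rw [← Finset.mul_sum]; exact Nat.mul_le_mul_left _ (hg t)
    _ = k := mul_one k

theorem MvPolynomial.pderiv_mem_restrictDegree {σ : Type*} {k : ℕ} (b : σ)
    {p : MvPolynomial σ ℝ} (hp : p ∈ restrictDegree σ ℝ k) :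
    pderiv b p ∈ restrictDegree σ ℝ k := by
  classical
  rw [p.as_sum, map_sum]
  refine Submodule.sum_mem _ fun m hm => ?_
  rw [pderiv_monomial, restrictDegree, monomial_mem_restrictSupport]
  refine Or.inl fun i => ?_
  exact (tsub_le_self (a := m i)).trans ((mem_restrictDegree _ _ _).1 hp m hm i)

/-- The polynomial `p (l + ℓ * x)`, with componentwise operations. -/
noncomputable def MvPolynomial.rescale {σ : Type*} (l ℓ : σ → ℝ) (p : MvPolynomial σ ℝ) :
    MvPolynomial σ ℝ :=
  aeval (fun b => C (l b) + C (ℓ b) * X b) p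

theorem MvPolynomial.eval_rescale {σ : Type*} (l ℓ : σ → ℝ) (p : MvPolynomial σ ℝ) (x : σ → ℝ) :
    eval x (rescale l ℓ p) = eval (fun b => l b + ℓ b * x b) p := by
  induction p using MvPolynomial.induction_on with
  | C a => simp [rescale]
  | add p q hp hq => simp_all [rescale]
  | mul_X p n hp => simp_all [rescale]

/-- The chain rule; its factor `ℓ b` becomes the edge length that accompanies the derivative in the
inverse estimate. -/
theorem MvPolynomial.pderiv_rescale {σ : Type*} (l ℓ : σ → ℝ) (p : MvPolynomial σ ℝ) (b : σ) :
    pderiv b (rescale l ℓ p) = C (ℓ b) * rescale l ℓ (pderiv b p) := by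
  classical
  induction p using MvPolynomial.induction_on with
  | C a => simp [rescale]
  | add p q hp hq => simp_all [rescale, mul_add]
  | mul_X p n hp =>
    simp only [rescale, map_mul, aeval_X, pderiv_mul, map_add] at hp ⊢
    rw [hp]
    rcases eq_or_ne n b with rfl | h
    · simp; ring
    · simp [pderiv_X_of_ne h]; ring

theorem MvPolynomial.rescale_mem_restrictDegree {d k : ℕ} (l ℓ : Fin d → ℝ)
    {p : MvPolynomial (Fin d) ℝ} (hp : p ∈ restrictDegree (Fin d) ℝ k) :
    rescale l ℓ p ∈ restrictDegree (Fin d) ℝ k := by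
  refine aeval_mem_restrictDegree (fun t => ?_) hp
  calc _ ≤ ∑ s, if t = s then 1 else 0 := by
        refine Finset.sum_le_sum fun s _ => (degreeOf_add_le _ _ _).trans ?_
        rw [degreeOf_C, Nat.zero_max]
        exact (degreeOf_C_mul_le _ _ _).trans (degreeOf_X _ _).le
    _ ≤ 1 := by simp

/-- The restriction of `p` to the hyperplane on which coordinate `a` equals `c`. -/
noncomputable def MvPolynomial.slice {n : ℕ} (a : Fin (n + 1)) (c : ℝ)
    (p : MvPolynomial (Fin (n + 1)) ℝ) : MvPolynomial (Fin n) ℝ :=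
  aeval (a.insertNth (C c) X : Fin (n + 1) → MvPolynomial (Fin n) ℝ) p

theorem MvPolynomial.eval_slice {n : ℕ} (a : Fin (n + 1)) (c : ℝ)
    (p : MvPolynomial (Fin (n + 1)) ℝ) (y : Fin n → ℝ) :
    eval y (slice a c p) = eval (a.insertNth c y : Fin (n + 1) → ℝ) p := by
  induction p using MvPolynomial.induction_on with
  | C a => simp [slice]
  | add p q hp hq => simp_all [slice]
  | mul_X p m hp =>
    simp only [slice, map_mul, aeval_X, eval_X] at hp ⊢
    rw [hp]
    congr 1
    refine Fin.succAboveCases a ?_ (fun i => ?_) m <;> simp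

theorem MvPolynomial.slice_mem_restrictDegree {n k : ℕ} (a : Fin (n + 1)) (c : ℝ)
    {p : MvPolynomial (Fin (n + 1)) ℝ} (hp : p ∈ restrictDegree (Fin (n + 1)) ℝ k) :
    slice a c p ∈ restrictDegree (Fin n) ℝ k := by
  refine aeval_mem_restrictDegree (fun t => ?_) hp
  rw [Fin.sum_univ_succAbove _ a]
  simp [degreeOf_X]

/-! ### Scaling from the unit cube to arbitrary boxes -/

theorem integral_Icc_eq_prod_mul_integral_unitCube {d : ℕ} {l u : Fin d → ℝ} (h : ∀ b, l b < u b)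
    (f : (Fin d → ℝ) → ℝ) :
    ∫ x in Set.Icc l u, f x =
      (∏ b, (u b - l b)) * ∫ y in Set.Icc (0 : Fin d → ℝ) 1, f (fun b => l b + (u b - l b) * y b) := by
  have hℓ : ∀ b, 0 < u b - l b := fun b => sub_pos.2 (h b)
  let A : (Fin d → ℝ) →L[ℝ] (Fin d → ℝ) :=
    LinearMap.toContinuousLinearMap (Matrix.toLin' (Matrix.diagonal fun b => u b - l b))
  have hA : ∀ y b, A y b = (u b - l b) * y b := by
    intro y b
    simp [A, Matrix.mulVec_diagonal]
  have hdet : A.det = ∏ b, (u b - l b) := by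
    simp [A, ContinuousLinearMap.det, LinearMap.det_toLin']
  have himg : (fun y : Fin d → ℝ => fun b => l b + (u b - l b) * y b) '' Set.Icc 0 1 =
      Set.Icc l u := by
    ext x
    constructor
    · rintro ⟨y, hy, rfl⟩
      refine ⟨fun b => ?_, fun b => ?_⟩
      · have := hy.1 b
        simp only [Pi.zero_apply] at this
        nlinarith [hℓ b]
      · have := hy.2 b
        simp only [Pi.one_apply] at this
        nlinarith [hℓ b]
    · intro hx
      refine ⟨fun b => (x b - l b) / (u b - l b), ⟨fun b => ?_, fun b => ?_⟩, ?_⟩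
      · exact div_nonneg (sub_nonneg.2 (hx.1 b)) (hℓ b).le
      · exact div_le_one_of_le₀ (sub_le_sub_right (hx.2 b) _) (hℓ b).le
      · ext b
        have := (hℓ b).ne'
        field_simp; ring
  have hinj : Set.InjOn (fun y : Fin d → ℝ => fun b => l b + (u b - l b) * y b) (Set.Icc 0 1) := by
    intro x _ y _ hxy
    ext b
    have := congrFun hxy b
    simpa [(hℓ b).ne'] using this
  have hderiv : ∀ x ∈ Set.Icc (0 : Fin d → ℝ) 1, HasFDerivWithinAt
      (fun y : Fin d → ℝ => fun b => l b + (u b - l b) * y b) A (Set.Icc 0 1) x := by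
    intro x _
    have : (fun y : Fin d → ℝ => fun b => l b + (u b - l b) * y b) = fun y => l + A y := by
      ext y b; simp [hA]
    rw [this]
    exact (A.hasFDerivWithinAt).const_add l
  rw [← himg, integral_image_eq_integral_abs_det_fderiv_smul volume measurableSet_Icc hderiv hinj,
    hdet, abs_of_pos (Finset.prod_pos fun b _ => hℓ b)]
  simp [integral_const_mul]

/-- The unit-cube constant survives unchanged because the affine map to the box scales each axis by
its own edge length. The parameter `R` admits points outside the box, which is needed to compare
neighbouring elements. -/
theorem MvPolynomial.exists_sq_eval_le_integral_Icc (d k : ℕ) (R : ℝ) :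
    ∃ C > 0, ∀ p ∈ restrictDegree (Fin d) ℝ k, ∀ l u : Fin d → ℝ, (∀ b, l b < u b) →
      ∀ x : Fin d → ℝ, (∀ b, |x b - l b| ≤ R * (u b - l b)) →
      (∏ b, (u b - l b)) * eval x p ^ 2 ≤ C * ∫ y in Set.Icc l u, eval y p ^ 2 ∧
      ∀ b, (∏ b, (u b - l b)) * ((u b - l b) * eval x (pderiv b p)) ^ 2 ≤
        C * ∫ y in Set.Icc l u, eval y p ^ 2 := by
  obtain ⟨C, hC, H⟩ := exists_sq_eval_le_integral_unitCube d k R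
  refine ⟨C, hC, fun p hp l u h x hx => ?_⟩
  have hℓ : ∀ b, 0 < u b - l b := fun b => sub_pos.2 (h b)
  have hprod : 0 < ∏ b, (u b - l b) := Finset.prod_pos fun b _ => hℓ b
  obtain ⟨h1, h2⟩ := H _ (rescale_mem_restrictDegree l (fun b => u b - l b) hp)
    (fun b => (x b - l b) / (u b - l b)) fun b => by
      rw [abs_div, abs_of_pos (hℓ b), div_le_iff₀ (hℓ b)]
      exact hx b
  have hxx : (fun b => l b + (u b - l b) * ((x b - l b) / (u b - l b))) = x := by
    ext b
    have := (hℓ b).ne'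
    field_simp; ring
  simp only [pderiv_rescale, eval_rescale, map_mul, eval_C, hxx] at h1 h2
  rw [integral_Icc_eq_prod_mul_integral_unitCube h, mul_left_comm]
  exact ⟨by gcongr, fun b => by gcongr; exact h2 b⟩

/-! ### Calculus of polynomial functions on Euclidean space -/

/-- The function on Euclidean space defined by a polynomial. -/
noncomputable def polyFun {d : ℕ} (p : MvPolynomial (Fin d) ℝ) (x : EuclideanSpace ℝ (Fin d)) : ℝ :=
  eval (fun a => x a) p

/-- The gradient of the function defined by a polynomial. -/
noncomputable def polyGrad {d : ℕ} (p : MvPolynomial (Fin d) ℝ) (x : EuclideanSpace ℝ (Fin d)) :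
    EuclideanSpace ℝ (Fin d) :=
  WithLp.toLp 2 fun a => polyFun (pderiv a p) x

section polyFun

variable {d : ℕ}

theorem polyFun_sub (p q : MvPolynomial (Fin d) ℝ) (x : EuclideanSpace ℝ (Fin d)) :
    polyFun (p - q) x = polyFun p x - polyFun q x := by simp [polyFun]

theorem contDiff_polyFun (p : MvPolynomial (Fin d) ℝ) {n : WithTop ℕ∞} :
    ContDiff ℝ n (polyFun p) := by
  induction p using MvPolynomial.induction_on with
  | C a =>
    have : polyFun (C a : MvPolynomial (Fin d) ℝ) = fun _ => a := by ext x; simp [polyFun]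
    rw [this]; exact contDiff_const
  | add p q hp hq =>
    have : polyFun (p + q) = fun x => polyFun p x + polyFun q x := by ext x; simp [polyFun]
    rw [this]; exact hp.add hq
  | mul_X p a hp =>
    have : polyFun (p * X a) = fun x => polyFun p x * x a := by ext x; simp [polyFun]
    rw [this]; exact hp.mul (by fun_prop)

theorem continuous_polyFun (p : MvPolynomial (Fin d) ℝ) : Continuous (polyFun p) :=
  (contDiff_polyFun p (n := 0)).continuous

theorem continuous_polyGrad (p : MvPolynomial (Fin d) ℝ) : Continuous (polyGrad p) := by
  unfold polyGrad
  have := fun q : MvPolynomial (Fin d) ℝ => continuous_polyFun q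
  fun_prop

theorem hasFDerivAt_polyFun (p : MvPolynomial (Fin d) ℝ) (x : EuclideanSpace ℝ (Fin d)) :
    HasFDerivAt (polyFun p)
      (∑ a, polyFun (pderiv a p) x • (EuclideanSpace.proj a : EuclideanSpace ℝ (Fin d) →L[ℝ] ℝ))
      x := by
  classical
  induction p using MvPolynomial.induction_on with
  | C a =>
    have : polyFun (C a : MvPolynomial (Fin d) ℝ) = fun _ => a := by ext x; simp [polyFun]
    rw [this]
    have h := hasFDerivAt_const (𝕜 := ℝ) a x
    convert! h using 1
    simp [polyFun]
  | add p q hp hq =>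
    have : polyFun (p + q) = fun x => polyFun p x + polyFun q x := by ext x; simp [polyFun]
    rw [this]
    convert! hp.add hq using 1
    simp [polyFun, add_smul, Finset.sum_add_distrib]
  | mul_X p b hp =>
    have : polyFun (p * X b) = fun x => polyFun p x *
        (EuclideanSpace.proj b : EuclideanSpace ℝ (Fin d) →L[ℝ] ℝ) x := by ext x; simp [polyFun]
    rw [this]
    convert! hp.mul (EuclideanSpace.proj b : EuclideanSpace ℝ (Fin d) →L[ℝ] ℝ).hasFDerivAt using 1
    ext v
    simp [polyFun, add_mul, Finset.sum_add_distrib, pderiv_X, Pi.single_apply,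
      Finset.mul_sum, apply_ite]
    exact Finset.sum_congr rfl fun i _ => by ring

theorem hasGradientAt_polyFun (p : MvPolynomial (Fin d) ℝ) (x : EuclideanSpace ℝ (Fin d)) :
    HasGradientAt (polyFun p) (polyGrad p x) x := by
  rw [hasGradientAt_iff_hasFDerivAt]
  convert! hasFDerivAt_polyFun p x using 1
  ext v
  simp [polyGrad, PiLp.inner_apply, mul_comm]

theorem norm_polyGrad_sq (p : MvPolynomial (Fin d) ℝ) (x : EuclideanSpace ℝ (Fin d)) :
    ‖polyGrad p x‖ ^ 2 = ∑ a, polyFun (pderiv a p) x ^ 2 := by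
  simp [polyGrad, EuclideanSpace.norm_sq_eq]

/-- Identifies the analytic derivative that defines the jump with formal differentiation, so that
the jump becomes a polynomial. -/
theorem iteratedFDeriv_polyFun_single (p : MvPolynomial (Fin d) ℝ) (a : Fin d) (m : ℕ)
    (x : EuclideanSpace ℝ (Fin d)) :
    iteratedFDeriv ℝ m (polyFun p) x (fun _ => EuclideanSpace.single a 1) =
      polyFun ((pderiv a)^[m] p) x := by
  induction m generalizing x with
  | zero => simp
  | succ m ih =>
    rw [DifferentiableAt.iteratedFDeriv_succ_apply_left']
    · have : (fun y => iteratedFDeriv ℝ m (polyFun p) y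
          (Fin.tail fun _ : Fin (m + 1) => EuclideanSpace.single a (1 : ℝ))) =
          polyFun ((pderiv a)^[m] p) := _root_.funext fun y => ih y
      rw [this, (hasFDerivAt_polyFun _ x).fderiv, Function.iterate_succ_apply']
      simp
    · exact (contDiff_polyFun p (n := (m + 1 : ℕ))).differentiable_iteratedFDeriv
        (by exact_mod_cast Nat.lt_succ_self m) x

end polyFun

/-! ### Closed boxes in Euclidean space -/

section closedBox

variable {d : ℕ} (I J : BoxIntegral.Box (Fin d))

theorem closedBox_eq_preimage :
    closedBox I = EuclideanSpace.equiv (Fin d) ℝ ⁻¹' Set.Icc I.lower I.upper := by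
  ext x
  simp [closedBox, Pi.le_def, forall_and]

theorem isClosed_closedBox : IsClosed (closedBox I) := by
  rw [closedBox_eq_preimage]
  exact isClosed_Icc.preimage (EuclideanSpace.equiv (Fin d) ℝ).continuous

theorem isCompact_closedBox : IsCompact (closedBox I) := by
  rw [closedBox_eq_preimage]
  exact (EuclideanSpace.equiv (Fin d) ℝ).toHomeomorph.isCompact_preimage.2 isCompact_Icc

theorem convex_closedBox : Convex ℝ (closedBox I) := by
  rw [closedBox_eq_preimage]
  exact (convex_Icc _ _).linear_preimage (EuclideanSpace.equiv (Fin d) ℝ).toLinearMap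

theorem interior_closedBox :
    interior (closedBox I) = {x | ∀ a, x a ∈ Set.Ioo (I.lower a) (I.upper a)} := by
  have := (EuclideanSpace.equiv (Fin d) ℝ).toHomeomorph.preimage_interior
    (Set.Icc I.lower I.upper)
  rw [closedBox_eq_preimage]
  refine this.symm.trans ?_
  rw [← Set.pi_univ_Icc, interior_pi_set Set.finite_univ]
  ext x
  simp

theorem interior_closedBox_nonempty : (interior (closedBox I)).Nonempty := by
  rw [interior_closedBox]
  refine ⟨WithLp.toLp 2 fun a => (I.lower a + I.upper a) / 2, fun a => ?_⟩
  have := I.lower_lt_upper a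
  constructor <;> simp <;> linarith

theorem uniqueDiffOn_closedBox : UniqueDiffOn ℝ (closedBox I) :=
  uniqueDiffOn_convex (convex_closedBox I) (interior_closedBox_nonempty I)

theorem volume_frontier_closedBox : volume (frontier (closedBox I)) = 0 :=
  (convex_closedBox I).addHaar_frontier _

theorem interior_ae_eq_closedBox :
    interior (closedBox I) =ᵐ[volume] closedBox I :=
  interior_ae_eq_of_null_frontier (volume_frontier_closedBox I)

theorem setIntegral_closedBox (f : (Fin d → ℝ) → ℝ) :
    ∫ x in closedBox I, f (fun a => x a) = ∫ y in Set.Icc I.lower I.upper, f y := by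
  have h := EuclideanSpace.volume_preserving_symm_measurableEquiv_toLp (Fin d)
  exact (closedBox_eq_preimage I) ▸ h.setIntegral_preimage_emb
    (MeasurableEquiv.measurableEmbedding _) f (Set.Icc I.lower I.upper)

theorem volume_real_closedBox : volume.real (closedBox I) = ∏ a, (I.upper a - I.lower a) := by
  have h1 := setIntegral_closedBox I (fun _ => 1)
  simp only [setIntegral_const, smul_eq_mul, mul_one] at h1
  rw [h1, measureReal_def, Real.volume_Icc_pi_toReal fun a => (I.lower_lt_upper a).le]

theorem volume_real_closedBox_pos : 0 < volume.real (closedBox I) := by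
  rw [volume_real_closedBox]
  exact Finset.prod_pos fun a _ => sub_pos.2 (I.lower_lt_upper a)

theorem exists_sq_polyFun_le_integral_closedBox (d k : ℕ) (R : ℝ) :
    ∃ C > 0, ∀ p ∈ restrictDegree (Fin d) ℝ k, ∀ I : BoxIntegral.Box (Fin d),
      ∀ x : EuclideanSpace ℝ (Fin d),
      (∀ b, |x b - I.lower b| ≤ R * (I.upper b - I.lower b)) →
      volume.real (closedBox I) * polyFun p x ^ 2 ≤ C * ∫ y in closedBox I, polyFun p y ^ 2 ∧
      ∀ b, volume.real (closedBox I) * ((I.upper b - I.lower b) * polyFun (pderiv b p) x) ^ 2 ≤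
        C * ∫ y in closedBox I, polyFun p y ^ 2 := by
  obtain ⟨C, hC, H⟩ := exists_sq_eval_le_integral_Icc d k R
  refine ⟨C, hC, fun p hp I x hx => ?_⟩
  have := H p hp I.lower I.upper I.lower_lt_upper (fun a => x a) hx
  rw [← volume_real_closedBox, ← setIntegral_closedBox I fun y => eval y p ^ 2] at this
  exact this

end closedBox

/-! ### Surface measure on coordinate hyperplanes -/

section hyperplane

variable {n : ℕ} (a : Fin (n + 1)) (c : ℝ)

/-- The parametrization of the hyperplane on which coordinate `a` equals `c`. -/
def hyperplaneEmb (y : EuclideanSpace ℝ (Fin n)) : EuclideanSpace ℝ (Fin (n + 1)) :=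
  WithLp.toLp 2 (a.insertNth c (fun i => y i) : Fin (n + 1) → ℝ)

theorem isometry_hyperplaneEmb : Isometry (hyperplaneEmb a c) := by
  refine Isometry.of_dist_eq fun x y => ?_
  simp [EuclideanSpace.dist_eq, hyperplaneEmb, Fin.sum_univ_succAbove _ a]

theorem range_hyperplaneEmb : Set.range (hyperplaneEmb a c) = {x | x a = c} := by
  ext x
  constructor
  · rintro ⟨y, rfl⟩
    simp [hyperplaneEmb]
  · rintro rfl
    exact ⟨WithLp.toLp 2 fun i => x (a.succAbove i),
      congrArg (WithLp.toLp 2) (Fin.insertNth_self_removeNth a (fun i => x i))⟩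

theorem polyFun_hyperplaneEmb (p : MvPolynomial (Fin (n + 1)) ℝ) (y : EuclideanSpace ℝ (Fin n)) :
    polyFun p (hyperplaneEmb a c y) = polyFun (slice a c p) y := by
  simp only [polyFun, eval_slice, hyperplaneEmb]

variable {a c} {S : Set (EuclideanSpace ℝ (Fin (n + 1)))}

/-- Isometries carry Hausdorff measure to Hausdorff measure on their range, and in `ℝ^n` the
normalized `n`-dimensional one is Lebesgue measure. Interface integrals thus become ordinary
integrals one dimension lower. -/
theorem restrict_surfaceMeasure_eq (hS : S ⊆ {x | x a = c}) :
    (surfaceMeasure (n + 1)).restrict S = (Measure.map (hyperplaneEmb a c) volume).restrict S := by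
  rw [← EuclideanSpace.euclideanHausdorffMeasure_eq_volume,
    (isometry_hyperplaneEmb a c).map_euclideanHausdorffMeasure, range_hyperplaneEmb,
    Measure.restrict_restrict_of_subset hS]
  rfl

theorem setIntegral_surfaceMeasure_eq (hS : S ⊆ {x | x a = c})
    (f : EuclideanSpace ℝ (Fin (n + 1)) → ℝ) :
    ∫ x in S, f x ∂(surfaceMeasure (n + 1)) =
      ∫ y in hyperplaneEmb a c ⁻¹' S, f (hyperplaneEmb a c y) := by
  rw [restrict_surfaceMeasure_eq hS]
  exact (isometry_hyperplaneEmb a c).isClosedEmbedding.measurableEmbedding.setIntegral_map f S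

theorem surfaceMeasure_eq_volume_preimage (hS : S ⊆ {x | x a = c}) :
    surfaceMeasure (n + 1) S = volume (hyperplaneEmb a c ⁻¹' S) := by
  rw [← Measure.restrict_apply_self, restrict_surfaceMeasure_eq hS, Measure.restrict_apply_self]
  exact (isometry_hyperplaneEmb a c).isClosedEmbedding.measurableEmbedding.map_apply _ S

theorem surfaceMeasure_lt_top_of_isBounded (hS : S ⊆ {x | x a = c}) (hb : Bornology.IsBounded S) :
    surfaceMeasure (n + 1) S < ⊤ := by
  rw [surfaceMeasure_eq_volume_preimage hS]
  refine Bornology.IsBounded.measure_lt_top ?_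
  exact (isometry_hyperplaneEmb a c).antilipschitz.isBounded_preimage hb

/-- The frontier is covered by finitely many bounded pieces of coordinate hyperplanes. Finiteness is
what makes the jumps square-integrable. -/
theorem surfaceMeasure_frontier_closedBox_lt_top (I : BoxIntegral.Box (Fin (n + 1))) :
    surfaceMeasure (n + 1) (frontier (closedBox I)) < ⊤ := by
  have hsub : frontier (closedBox I) ⊆ ⋃ a, ((closedBox I ∩ {x | x a = I.lower a}) ∪
      (closedBox I ∩ {x | x a = I.upper a})) := by
    intro x hx
    have hxI : x ∈ closedBox I := (isClosed_closedBox I).frontier_subset hx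
    have hxi : x ∉ interior (closedBox I) := hx.2
    rw [interior_closedBox] at hxi
    simp only [Set.mem_ofPred_eq, not_forall] at hxi
    obtain ⟨a, ha⟩ := hxi
    refine Set.mem_iUnion.2 ⟨a, ?_⟩
    by_cases h : x a = I.lower a
    · exact Or.inl ⟨hxI, h⟩
    · refine Or.inr ⟨hxI, ?_⟩
      by_contra h'
      exact ha ⟨lt_of_le_of_ne (hxI a).1 (Ne.symm h), lt_of_le_of_ne (hxI a).2 h'⟩
  refine (measure_mono hsub).trans_lt ((measure_iUnion_le _).trans_lt ?_)
  rw [tsum_fintype]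
  refine ENNReal.sum_lt_top.2 fun a _ => (measure_union_le _ _).trans_lt ?_
  have hb := (isCompact_closedBox I).isBounded
  exact ENNReal.add_lt_top.2 ⟨surfaceMeasure_lt_top_of_isBounded Set.inter_subset_right
    (hb.subset Set.inter_subset_left), surfaceMeasure_lt_top_of_isBounded Set.inter_subset_right
    (hb.subset Set.inter_subset_left)⟩

end hyperplane

/-- The Cauchy–Schwarz inequality for square-integrable real functions. -/
theorem abs_integral_mul_le_sqrt_mul_sqrt {α : Type*} [MeasurableSpace α] {μ : Measure α}
    {f g : α → ℝ} (hf : MemLp f 2 μ) (hg : MemLp g 2 μ) :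
    |∫ x, f x * g x ∂μ| ≤ √(∫ x, f x ^ 2 ∂μ) * √(∫ x, g x ^ 2 ∂μ) := by
  refine (abs_integral_le_integral_abs).trans ?_
  have h := integral_mul_le_Lp_mul_Lq_of_nonneg (μ := μ) (f := fun x => |f x|)
    (g := fun x => |g x|) Real.HolderConjugate.two_two (.of_forall fun _ => abs_nonneg _)
    (.of_forall fun _ => abs_nonneg _) (by simpa using! hf.abs) (by simpa using! hg.abs)
  simp only [Real.rpow_two, sq_abs, ← Real.sqrt_eq_rpow, abs_mul] at h ⊢
  exact h

theorem ContinuousOn.memLp_restrict_of_subset_isCompact {E F : Type*} [TopologicalSpace E]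
    [T2Space E] [MeasurableSpace E] [OpensMeasurableSpace E] [NormedAddCommGroup F]
    [SecondCountableTopologyEither E F] {μ : Measure E} {f : E → F} {K S : Set E} {p : ENNReal}
    (hf : ContinuousOn f K) (hK : IsCompact K) (hSK : S ⊆ K) (hS : MeasurableSet S)
    (hμ : μ S < ⊤) : MemLp f p (μ.restrict S) := by
  have : IsFiniteMeasure (μ.restrict S) := ⟨by simpa using hμ⟩
  obtain ⟨B, hB⟩ := hK.exists_bound_of_continuousOn hf
  exact MemLp.of_bound ((hf.mono hSK).aestronglyMeasurable hS) B
    ((ae_restrict_mem hS).mono fun x hx => hB x (hSK hx))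

/-! ### Piecewise polynomial form and square-integrability of splines -/

namespace ImmersedMesh

variable {d k : ℕ} (D : ImmersedMesh d)

/-- The function `u` is given by the polynomial `P i` on each background element `i`. -/
def IsPiecewise (k : ℕ) (u : EuclideanSpace ℝ (Fin d) → ℝ)
    (P : Fin D.n → MvPolynomial (Fin d) ℝ) : Prop :=
  ∀ i ∈ D.active, P i ∈ restrictDegree (Fin d) ℝ k ∧ Set.EqOn u (polyFun (P i)) (D.cell i)

theorem exists_isPiecewise {u : EuclideanSpace ℝ (Fin d) → ℝ} (hu : u ∈ D.splineSpace k) :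
    ∃ P, D.IsPiecewise k u P := by
  classical
  choose! P hP using hu.2
  exact ⟨P, hP⟩

variable {D} {i j : Fin D.n}

theorem isClosed_cell : IsClosed (D.cell i) := isClosed_closedBox _

theorem isCompact_cell : IsCompact (D.cell i) := isCompact_closedBox _

theorem measurableSet_cell : MeasurableSet (D.cell i) := isClosed_cell.measurableSet

theorem uniqueDiffOn_cell : UniqueDiffOn ℝ (D.cell i) := uniqueDiffOn_closedBox _

theorem mem_active_of_mem {x : EuclideanSpace ℝ (Fin d)} (hx : x ∈ D.Ω) (hi : x ∈ D.cell i) :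
    i ∈ D.active := by
  simp only [active, Finset.mem_filter, Finset.mem_univ, true_and]
  exact ⟨x, hi, hx⟩

theorem Ω_subset_region : D.Ω ⊆ D.region := by
  intro x hx
  obtain ⟨i, hi⟩ := Set.mem_iUnion.1 (D.subset_ambient hx)
  exact Set.mem_biUnion (mem_active_of_mem hx hi) hi

theorem cell_subset_region (hi : i ∈ D.active) : D.cell i ⊆ D.region :=
  Set.subset_biUnion_of_mem (u := D.cell) hi

theorem isCompact_region : IsCompact D.region :=
  D.active.isCompact_biUnion fun _ _ => isCompact_cell

theorem face_subset_cell : D.face i ⊆ D.cell i := fun _ hx =>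
  isClosed_cell.closure_subset_iff.2 Set.inter_subset_left (frontier_subset_closure hx.1)

theorem face_subset_frontier : D.face i ⊆ frontier D.Ω := Set.inter_subset_right

theorem isClosed_face : IsClosed (D.face i) := isClosed_frontier.inter isClosed_frontier

theorem dirichletFace_subset_face : D.dirichletFace i ⊆ D.face i := Set.inter_subset_left

theorem surfaceMeasure_face_lt_top : surfaceMeasure d (D.face i) < ⊤ :=
  (measure_mono face_subset_frontier).trans_lt D.surface_lt_top

theorem isClosed_interface : IsClosed (D.interface i j) := isClosed_frontier.inter isClosed_frontier

theorem interface_subset_cell_left : D.interface i j ⊆ D.cell i :=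
  Set.inter_subset_left.trans isClosed_cell.frontier_subset

theorem interface_subset_cell_right : D.interface i j ⊆ D.cell j :=
  Set.inter_subset_right.trans isClosed_cell.frontier_subset

theorem surfaceMeasure_interface_lt_top (hd : 1 ≤ d) :
    surfaceMeasure d (D.interface i j) < ⊤ := by
  obtain ⟨n, rfl⟩ : ∃ n, d = n + 1 := ⟨d - 1, by omega⟩
  exact (measure_mono Set.inter_subset_left).trans_lt (surfaceMeasure_frontier_closedBox_lt_top _)

theorem meshSize_pos : 0 < D.meshSize i :=
  Real.rpow_pos_of_pos (volume_real_closedBox_pos _) _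

theorem interfaceSize_pos : 0 < D.interfaceSize i j := lt_max_of_lt_left meshSize_pos

/-- Box frontiers are null. The unrestricted gradient of a spline is identified with a polynomial
gradient only in element interiors, and this suffices for integrals. -/
theorem ae_mem_interior_cell :
    ∀ᵐ x ∂volume.restrict D.region, ∃ i ∈ D.active, x ∈ interior (D.cell i) := by
  have h : ∀ᵐ x ∂(volume : Measure (EuclideanSpace ℝ (Fin d))), ∀ i, x ∉ frontier (D.cell i) := by
    rw [ae_all_iff]
    exact fun i => measure_eq_zero_iff_ae_notMem.1 (volume_frontier_closedBox _)
  filter_upwards [ae_restrict_of_ae h, ae_restrict_mem isCompact_region.isClosed.measurableSet]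
    with x hx hxr
  obtain ⟨i, hi, hxi⟩ := Set.mem_iUnion₂.1 hxr
  refine ⟨i, hi, ?_⟩
  by_contra h'
  exact hx i ⟨subset_closure hxi, h'⟩

variable {u v : EuclideanSpace ℝ (Fin d) → ℝ} {P : Fin D.n → MvPolynomial (Fin d) ℝ}
  {x : EuclideanSpace ℝ (Fin d)}

namespace IsPiecewise

theorem gradient_eq (h : D.IsPiecewise k u P) (hi : i ∈ D.active) (hx : x ∈ interior (D.cell i)) :
    gradient u x = polyGrad (P i) x := by
  refine HasGradientAt.gradient ((hasGradientAt_polyFun (P i) x).congr_of_eventuallyEq ?_)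
  filter_upwards [mem_interior_iff_mem_nhds.1 hx] with y hy using (h i hi).2 hy

theorem gradientWithin_eq (h : D.IsPiecewise k u P) (hi : i ∈ D.active) (hx : x ∈ D.cell i) :
    gradientWithin u (D.cell i) x = polyGrad (P i) x := by
  rw [gradientWithin, fderivWithin_congr (h i hi).2 ((h i hi).2 hx),
    (hasGradientAt_polyFun (P i) x).hasFDerivAt.hasFDerivWithinAt.fderivWithin
      (uniqueDiffOn_cell x hx), LinearIsometryEquiv.symm_apply_apply]

theorem normalDeriv_eq (h : D.IsPiecewise k u P) (hi : i ∈ D.active) (hx : x ∈ D.cell i) :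
    D.normalDeriv u i x = inner ℝ (polyGrad (P i) x) (D.normal x) := by
  rw [normalDeriv, h.gradientWithin_eq hi hx]

theorem iteratedFDerivWithin_eq (h : D.IsPiecewise k u P) (hi : i ∈ D.active)
    (hx : x ∈ D.cell i) (m : ℕ) :
    iteratedFDerivWithin ℝ m u (D.cell i) x = iteratedFDeriv ℝ m (polyFun (P i)) x := by
  rw [iteratedFDerivWithin_congr (h i hi).2 hx, iteratedFDerivWithin_eq_iteratedFDeriv
    uniqueDiffOn_cell (contDiff_polyFun _).contDiffAt hx]

theorem jump_eq (h : D.IsPiecewise k u P) (hi : i ∈ D.active) (hj : j ∈ D.active)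
    (hx : x ∈ D.interface i j) :
    D.jump k u i j x =
      iteratedFDeriv ℝ k (polyFun (P i)) x (fun _ => D.interfaceNormal i j) -
      iteratedFDeriv ℝ k (polyFun (P j)) x (fun _ => D.interfaceNormal i j) := by
  rw [jump, h.iteratedFDerivWithin_eq hi (interface_subset_cell_left hx),
    h.iteratedFDerivWithin_eq hj (interface_subset_cell_right hx)]

/-- Measurability is automatic, since the derivative of any function is measurable; the gradient is
bounded almost everywhere by the maxima of finitely many polynomial gradients. -/
theorem memLp_gradient (h : D.IsPiecewise k u P) :
    MemLp (gradient u) 2 (volume.restrict D.region) := by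
  have : IsFiniteMeasure (volume.restrict D.region) :=
    ⟨by simpa using isCompact_region.measure_lt_top⟩
  have hb : ∀ i, ∃ B, ∀ x ∈ D.cell i, ‖polyGrad (P i) x‖ ≤ B := fun i =>
    isCompact_cell.exists_bound_of_continuousOn (continuous_polyGrad (P i)).continuousOn
  choose B hB using hb
  have hm : Measurable (gradient u) :=
    ((InnerProductSpace.toDual ℝ _).symm.continuous.measurable).comp (measurable_fderiv ℝ u)
  refine MemLp.of_bound hm.aestronglyMeasurable (∑ i, |B i|) ?_
  filter_upwards [ae_mem_interior_cell] with x ⟨i, hi, hx⟩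
  rw [h.gradient_eq hi hx]
  exact (hB i x (interior_subset hx)).trans ((le_abs_self _).trans
    (Finset.single_le_sum (f := fun i => |B i|) (fun i _ => abs_nonneg _) (Finset.mem_univ i)))

theorem memLp_face (h : D.IsPiecewise k u P) (hi : i ∈ D.active) :
    MemLp u 2 ((surfaceMeasure d).restrict (D.face i)) := by
  refine ContinuousOn.memLp_restrict_of_subset_isCompact (K := D.cell i) ?_ isCompact_cell
    face_subset_cell isClosed_face.measurableSet surfaceMeasure_face_lt_top
  exact (continuous_polyFun (P i)).continuousOn.congr (h i hi).2

theorem ae_norm_normal :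
    ∀ᵐ x ∂(surfaceMeasure d).restrict (D.face i), ‖D.normal x‖ = 1 :=
  ae_restrict_of_ae_restrict_of_subset face_subset_frontier
    (D.normal_spec.mono fun _ hx => hx.1)

theorem memLp_normalDeriv (h : D.IsPiecewise k u P) (hi : i ∈ D.active) :
    MemLp (D.normalDeriv u i) 2 ((surfaceMeasure d).restrict (D.face i)) := by
  have : IsFiniteMeasure ((surfaceMeasure d).restrict (D.face i)) :=
    ⟨by simpa using surfaceMeasure_face_lt_top⟩
  obtain ⟨B, hB⟩ := (isCompact_cell (D := D) (i := i)).exists_bound_of_continuousOn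
    (continuous_polyGrad (P i)).continuousOn
  have hm : Measurable fun x => inner ℝ (polyGrad (P i) x) (D.normal x) :=
    (continuous_polyGrad (P i)).measurable.inner D.measurable_normal
  have heq : ∀ᵐ x ∂(surfaceMeasure d).restrict (D.face i),
      D.normalDeriv u i x = inner ℝ (polyGrad (P i) x) (D.normal x) :=
    (ae_restrict_mem isClosed_face.measurableSet).mono fun x hx =>
      h.normalDeriv_eq hi (face_subset_cell hx)
  refine MemLp.of_bound (hm.aestronglyMeasurable.congr (heq.mono fun x hx => hx.symm)) B ?_
  filter_upwards [heq, ae_norm_normal, ae_restrict_mem isClosed_face.measurableSet] with x h1 h2 h3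
  rw [h1]
  exact (norm_inner_le_norm _ _).trans (by rw [h2, mul_one]; exact hB x (face_subset_cell h3))

theorem memLp_jump (hd : 1 ≤ d) (h : D.IsPiecewise k u P) (hi : i ∈ D.active)
    (hj : j ∈ D.active) :
    MemLp (D.jump k u i j) 2 ((surfaceMeasure d).restrict (D.interface i j)) := by
  refine ContinuousOn.memLp_restrict_of_subset_isCompact (K := D.interface i j) ?_
    (isCompact_cell.of_isClosed_subset isClosed_interface interface_subset_cell_left)
    subset_rfl isClosed_interface.measurableSet (surfaceMeasure_interface_lt_top hd)
  refine ContinuousOn.congr (Continuous.continuousOn ?_) fun x hx => h.jump_eq hi hj hx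
  have := fun p : MvPolynomial (Fin d) ℝ =>
    (contDiff_polyFun p (n := k)).continuous_iteratedFDeriv'
  have h1 := this (P i)
  have h2 := this (P j)
  fun_prop

end IsPiecewise

end ImmersedMesh

/-- A finite sum of products that are dominated termwise as in the Cauchy–Schwarz inequality is
dominated in the same way. -/
theorem Finset.abs_sum_le_sqrt_mul_sqrt {ι : Type*} (s : Finset ι) {f a b : ι → ℝ}
    (ha : ∀ i, 0 ≤ a i) (hb : ∀ i, 0 ≤ b i) (h : ∀ i ∈ s, |f i| ≤ √(a i) * √(b i)) :
    |∑ i ∈ s, f i| ≤ √(∑ i ∈ s, a i) * √(∑ i ∈ s, b i) := by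
  exact (Finset.abs_sum_le_sum_abs _ _).trans ((Finset.sum_le_sum h).trans
    (Real.sum_sqrt_mul_sqrt_le s ha hb))

/-! ### The terms of the energy norm, continuity, and the form on the diagonal -/

namespace ImmersedMesh

variable {d : ℕ} (D : ImmersedMesh d) (k : ℕ) (βt : Fin D.n → ℝ) (γt : Fin D.n → Fin D.n → ℝ)
  (u v : EuclideanSpace ℝ (Fin d) → ℝ)

/-- The squared `L²` norm of the gradient over the background mesh. -/
noncomputable def gradTerm : ℝ := ∫ x in D.region, ‖gradient u x‖ ^ 2

/-- The squared `L²` norm of the gradient over the physical domain. -/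
noncomputable def physTerm : ℝ := ∫ x in D.Ω, ‖gradient u x‖ ^ 2

/-- The squared weighted `L²` norm of the normal derivative over the Dirichlet boundary. -/
noncomputable def fluxTerm : ℝ :=
  ∑ i ∈ D.active, ∫ x in D.dirichletFace i, (βt i)⁻¹ * D.normalDeriv u i x ^ 2 ∂(surfaceMeasure d)

/-- The squared weighted `L²` norm of the trace on the Dirichlet boundary. -/
noncomputable def traceTerm : ℝ :=
  ∑ i ∈ D.active, ∫ x in D.dirichletFace i, βt i * u x ^ 2 ∂(surfaceMeasure d)

/-- The squared weighted `L²` norm of the jumps over the ghost mesh. -/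
noncomputable def ghostTerm : ℝ :=
  ∑ p ∈ D.ghost, ∫ x in D.interface p.1 p.2,
    γt p.1 p.2 * D.jump k u p.1 p.2 x ^ 2 ∂(surfaceMeasure d)

variable {D k βt γt u v}

theorem mem_ghost {p : Fin D.n × Fin D.n} : p ∈ D.ghost ↔
    (p.1 ∈ D.active ∧ p.2 ∈ D.active) ∧ p.1 < p.2 ∧ (D.IsCut p.1 ∨ D.IsCut p.2) := by
  simp [ghost]

theorem gradTerm_nonneg : 0 ≤ D.gradTerm u := integral_nonneg fun _ => sq_nonneg _

theorem physTerm_nonneg : 0 ≤ D.physTerm u := integral_nonneg fun _ => sq_nonneg _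

theorem fluxTerm_nonneg (hβ : ∀ i, 0 < βt i) : 0 ≤ D.fluxTerm βt u :=
  Finset.sum_nonneg fun i _ => integral_nonneg fun _ =>
    mul_nonneg (inv_nonneg.2 (hβ i).le) (sq_nonneg _)

theorem traceTerm_nonneg (hβ : ∀ i, 0 < βt i) : 0 ≤ D.traceTerm βt u :=
  Finset.sum_nonneg fun i _ => integral_nonneg fun _ => mul_nonneg (hβ i).le (sq_nonneg _)

theorem ghostTerm_nonneg (hγ : ∀ i j, 0 ≤ γt i j) : 0 ≤ D.ghostTerm k γt u :=
  Finset.sum_nonneg fun p _ => integral_nonneg fun _ => mul_nonneg (hγ p.1 p.2) (sq_nonneg _)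

theorem energyNorm_sq (hβ : ∀ i, 0 < βt i) (hγ : ∀ i j, 0 ≤ γt i j) :
    D.energyNorm k βt γt u ^ 2 =
      D.gradTerm u + D.fluxTerm βt u + D.traceTerm βt u + D.ghostTerm k γt u :=
  Real.sq_sqrt <| add_nonneg (add_nonneg (add_nonneg gradTerm_nonneg (fluxTerm_nonneg hβ))
    (traceTerm_nonneg hβ)) (ghostTerm_nonneg hγ)

theorem memLp_gradient (hu : u ∈ D.splineSpace k) :
    MemLp (gradient u) 2 (volume.restrict D.region) := by
  obtain ⟨P, hP⟩ := D.exists_isPiecewise hu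
  exact hP.memLp_gradient

theorem memLp_dirichletFace (hu : u ∈ D.splineSpace k) {i : Fin D.n} (hi : i ∈ D.active) :
    MemLp u 2 ((surfaceMeasure d).restrict (D.dirichletFace i)) := by
  obtain ⟨P, hP⟩ := D.exists_isPiecewise hu
  exact (hP.memLp_face hi).mono_measure (Measure.restrict_mono dirichletFace_subset_face le_rfl)

theorem memLp_normalDeriv (hu : u ∈ D.splineSpace k) {i : Fin D.n} (hi : i ∈ D.active) :
    MemLp (D.normalDeriv u i) 2 ((surfaceMeasure d).restrict (D.dirichletFace i)) := by
  obtain ⟨P, hP⟩ := D.exists_isPiecewise hu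
  exact (hP.memLp_normalDeriv hi).mono_measure
    (Measure.restrict_mono dirichletFace_subset_face le_rfl)

theorem memLp_jump (hd : 1 ≤ d) (hu : u ∈ D.splineSpace k) {p : Fin D.n × Fin D.n}
    (hp : p ∈ D.ghost) :
    MemLp (D.jump k u p.1 p.2) 2 ((surfaceMeasure d).restrict (D.interface p.1 p.2)) := by
  obtain ⟨P, hP⟩ := D.exists_isPiecewise hu
  have := (mem_ghost.1 hp).1
  exact hP.memLp_jump hd this.1 this.2

theorem physTerm_le_gradTerm (hu : u ∈ D.splineSpace k) : D.physTerm u ≤ D.gradTerm u :=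
  setIntegral_mono_set ((memLp_gradient hu).integrable_norm_pow two_ne_zero)
    (.of_forall fun _ => sq_nonneg _) Ω_subset_region.eventuallyLE

theorem abs_integral_inner_gradient_le (hu : u ∈ D.splineSpace k) (hv : v ∈ D.splineSpace k) :
    |∫ x in D.Ω, inner ℝ (gradient u x) (gradient v x)| ≤
      √(D.gradTerm u) * √(D.gradTerm v) := by
  have hle : volume.restrict D.Ω ≤ volume.restrict D.region :=
    Measure.restrict_mono Ω_subset_region le_rfl
  have hu' := ((memLp_gradient hu).mono_measure hle).norm
  have hv' := ((memLp_gradient hv).mono_measure hle).norm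
  calc |∫ x in D.Ω, inner ℝ (gradient u x) (gradient v x)|
      ≤ ∫ x in D.Ω, ‖gradient u x‖ * ‖gradient v x‖ :=
        norm_integral_le_of_norm_le (μ := volume.restrict D.Ω)
          (f := fun x => inner ℝ (gradient u x) (gradient v x))
          (g := fun x => ‖gradient u x‖ * ‖gradient v x‖) (hu'.integrable_mul hv')
          (.of_forall fun x => norm_inner_le_norm _ _)
    _ ≤ √(D.physTerm u) * √(D.physTerm v) :=
        (le_abs_self _).trans (abs_integral_mul_le_sqrt_mul_sqrt hu' hv')
    _ ≤ _ := mul_le_mul (Real.sqrt_le_sqrt (physTerm_le_gradTerm hu))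
        (Real.sqrt_le_sqrt (physTerm_le_gradTerm hv)) (Real.sqrt_nonneg _) (Real.sqrt_nonneg _)

/-- The weights of the two norms are inverse to each other on every element and cancel in the
Cauchy–Schwarz inequality. -/
theorem abs_sum_normalDeriv_mul_le (hβ : ∀ i, 0 < βt i) (hu : u ∈ D.splineSpace k)
    (hv : v ∈ D.splineSpace k) :
    |∑ i ∈ D.active, ∫ x in D.dirichletFace i, D.normalDeriv u i x * v x ∂(surfaceMeasure d)| ≤
      √(D.fluxTerm βt u) * √(D.traceTerm βt v) := by
  refine D.active.abs_sum_le_sqrt_mul_sqrt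
    (fun i => integral_nonneg fun _ => mul_nonneg (inv_nonneg.2 (hβ i).le) (sq_nonneg _))
    (fun i => integral_nonneg fun _ => mul_nonneg (hβ i).le (sq_nonneg _)) fun i hi => ?_
  refine (abs_integral_mul_le_sqrt_mul_sqrt (memLp_normalDeriv hu hi)
    (memLp_dirichletFace hv hi)).trans_eq ?_
  rw [integral_const_mul, integral_const_mul, Real.sqrt_mul (inv_nonneg.2 (hβ i).le),
    Real.sqrt_mul (hβ i).le, Real.sqrt_inv]
  have := (Real.sqrt_pos.2 (hβ i)).ne'
  field_simp

theorem abs_sum_trace_mul_le (hβ : ∀ i, 0 < βt i) (hu : u ∈ D.splineSpace k)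
    (hv : v ∈ D.splineSpace k) :
    |∑ i ∈ D.active, ∫ x in D.dirichletFace i, βt i * (u x * v x) ∂(surfaceMeasure d)| ≤
      √(D.traceTerm βt u) * √(D.traceTerm βt v) := by
  refine D.active.abs_sum_le_sqrt_mul_sqrt
    (fun i => integral_nonneg fun _ => mul_nonneg (hβ i).le (sq_nonneg _))
    (fun i => integral_nonneg fun _ => mul_nonneg (hβ i).le (sq_nonneg _)) fun i hi => ?_
  simp only [integral_const_mul]
  rw [Real.sqrt_mul (hβ i).le, Real.sqrt_mul (hβ i).le, mul_mul_mul_comm,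
    Real.mul_self_sqrt (hβ i).le, abs_mul, abs_of_pos (hβ i)]
  exact mul_le_mul_of_nonneg_left (abs_integral_mul_le_sqrt_mul_sqrt (memLp_dirichletFace hu hi)
    (memLp_dirichletFace hv hi)) (hβ i).le

theorem abs_sum_jump_mul_le (hd : 1 ≤ d) (hγ : ∀ i j, 0 ≤ γt i j) (hu : u ∈ D.splineSpace k)
    (hv : v ∈ D.splineSpace k) :
    |∑ p ∈ D.ghost, ∫ x in D.interface p.1 p.2, γt p.1 p.2 *
      (D.jump k u p.1 p.2 x * D.jump k v p.1 p.2 x) ∂(surfaceMeasure d)| ≤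
      √(D.ghostTerm k γt u) * √(D.ghostTerm k γt v) := by
  refine D.ghost.abs_sum_le_sqrt_mul_sqrt
    (fun p => integral_nonneg fun _ => mul_nonneg (hγ _ _) (sq_nonneg _))
    (fun p => integral_nonneg fun _ => mul_nonneg (hγ _ _) (sq_nonneg _)) fun p hp => ?_
  simp only [integral_const_mul]
  rw [Real.sqrt_mul (hγ _ _), Real.sqrt_mul (hγ _ _), mul_mul_mul_comm,
    Real.mul_self_sqrt (hγ _ _), abs_mul, abs_of_nonneg (hγ _ _)]
  exact mul_le_mul_of_nonneg_left (abs_integral_mul_le_sqrt_mul_sqrt (memLp_jump hd hu hp)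
    (memLp_jump hd hv hp)) (hγ _ _)

theorem sum_normalDeriv_mul_add_eq (hu : u ∈ D.splineSpace k) (hv : v ∈ D.splineSpace k) :
    (∑ i ∈ D.active, ∫ x in D.dirichletFace i,
      (D.normalDeriv u i x * v x + u x * D.normalDeriv v i x) ∂(surfaceMeasure d)) =
    (∑ i ∈ D.active, ∫ x in D.dirichletFace i, D.normalDeriv u i x * v x ∂(surfaceMeasure d)) +
    ∑ i ∈ D.active, ∫ x in D.dirichletFace i, D.normalDeriv v i x * u x ∂(surfaceMeasure d) := by
  rw [← Finset.sum_add_distrib]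
  refine Finset.sum_congr rfl fun i hi => ?_
  simp only [mul_comm (u _)]
  exact integral_add ((memLp_normalDeriv hu hi).integrable_mul (memLp_dirichletFace hv hi))
    ((memLp_normalDeriv hv hi).integrable_mul (memLp_dirichletFace hu hi))

/-- Continuity of the Nitsche form with respect to the energy norm. -/
theorem form_le (hd : 1 ≤ d) (hβ : ∀ i, 0 < βt i) (hγ : ∀ i j, 0 ≤ γt i j)
    (hu : u ∈ D.splineSpace k) (hv : v ∈ D.splineSpace k) :
    D.form k βt γt u v ≤ 5 * D.energyNorm k βt γt u * D.energyNorm k βt γt v := by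
  have hE : ∀ w, √(D.gradTerm w) ≤ D.energyNorm k βt γt w ∧
      √(D.fluxTerm βt w) ≤ D.energyNorm k βt γt w ∧
      √(D.traceTerm βt w) ≤ D.energyNorm k βt γt w ∧
      √(D.ghostTerm k γt w) ≤ D.energyNorm k βt γt w := by
    intro w
    have h1 := gradTerm_nonneg (D := D) (u := w)
    have h2 := fluxTerm_nonneg (D := D) (u := w) hβ
    have h3 := traceTerm_nonneg (D := D) (u := w) hβ
    have h4 := ghostTerm_nonneg (D := D) (k := k) (u := w) hγ
    change _ ≤ √(D.gradTerm w + D.fluxTerm βt w + D.traceTerm βt w + D.ghostTerm k γt w) ∧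
      _ ≤ √(D.gradTerm w + D.fluxTerm βt w + D.traceTerm βt w + D.ghostTerm k γt w) ∧
      _ ≤ √(D.gradTerm w + D.fluxTerm βt w + D.traceTerm βt w + D.ghostTerm k γt w) ∧
      _ ≤ √(D.gradTerm w + D.fluxTerm βt w + D.traceTerm βt w + D.ghostTerm k γt w)
    refine ⟨?_, ?_, ?_, ?_⟩ <;> exact Real.sqrt_le_sqrt (by linarith)
  have hmul : ∀ {x y : ℝ}, 0 ≤ y → x ≤ D.energyNorm k βt γt u → y ≤ D.energyNorm k βt γt v →
      x * y ≤ D.energyNorm k βt γt u * D.energyNorm k βt γt v := fun hy h1 h2 =>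
    mul_le_mul h1 h2 hy (Real.sqrt_nonneg _)
  obtain ⟨u1, u2, u3, u4⟩ := hE u
  obtain ⟨v1, v2, v3, v4⟩ := hE v
  have b1 := (abs_le.1 (abs_integral_inner_gradient_le hu hv)).2
  have b2 := (abs_le.1 (abs_sum_normalDeriv_mul_le hβ hu hv)).1
  have b3 := (abs_le.1 (abs_sum_normalDeriv_mul_le hβ hv hu)).1
  have b4 := (abs_le.1 (abs_sum_trace_mul_le hβ hu hv)).2
  have b5 := (abs_le.1 (abs_sum_jump_mul_le hd hγ hu hv)).2
  have c1 := hmul (Real.sqrt_nonneg _) u1 v1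
  have c2 := hmul (Real.sqrt_nonneg _) u2 v3
  have c3 := hmul (Real.sqrt_nonneg _) u3 v2
  have c4 := hmul (Real.sqrt_nonneg _) u3 v3
  have c5 := hmul (Real.sqrt_nonneg _) u4 v4
  -- The symmetric boundary term splits into two flux–trace products, giving five products in all.
  rw [form, sum_normalDeriv_mul_add_eq hu hv]
  rw [mul_comm] at c3
  linarith

/-- The cross term is kept as a product of roots so that the weight in Young's inequality can be
adapted to `β` later. -/
theorem le_form_self (hβ : ∀ i, 0 < βt i) (hu : u ∈ D.splineSpace k) :
    D.physTerm u - 2 * (√(D.fluxTerm βt u) * √(D.traceTerm βt u)) + D.traceTerm βt u +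
      D.ghostTerm k γt u ≤ D.form k βt γt u u := by
  have b := (abs_le.1 (abs_sum_normalDeriv_mul_le hβ hu hu)).2
  rw [form, sum_normalDeriv_mul_add_eq hu hu]
  simp only [real_inner_self_eq_norm_sq, ← sq]
  change _ ≤ D.physTerm u - _ + D.traceTerm βt u + D.ghostTerm k γt u
  linarith

end ImmersedMesh

/-! ### Coercivity from the trace and ghost inequalities -/

namespace ImmersedMesh

variable {d k : ℕ} {D : ImmersedMesh d} {u : EuclideanSpace ℝ (Fin d) → ℝ}
  {P : Fin D.n → MvPolynomial (Fin d) ℝ} {i j : Fin D.n}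

theorem setIntegral_interior_cell (f : EuclideanSpace ℝ (Fin d) → ℝ) :
    ∫ x in interior (D.cell i), f x = ∫ x in D.cell i, f x :=
  setIntegral_congr_set (interior_ae_eq_closedBox _)

/-- Elements agree with their pairwise disjoint interiors up to null sets, so the sum is one
integral over a subset of `T`. -/
theorem sum_setIntegral_cell_le {s : Finset (Fin D.n)} {T : Set (EuclideanSpace ℝ (Fin d))}
    {f : EuclideanSpace ℝ (Fin d) → ℝ} (hf : IntegrableOn f T) (h0 : ∀ x, 0 ≤ f x)
    (hT : ∀ i ∈ s, interior (D.cell i) ⊆ T) :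
    ∑ i ∈ s, ∫ x in D.cell i, f x ≤ ∫ x in T, f x := by
  calc ∑ i ∈ s, ∫ x in D.cell i, f x = ∑ i ∈ s, ∫ x in interior (D.cell i), f x :=
        Finset.sum_congr rfl fun i _ => (setIntegral_interior_cell f).symm
    _ = ∫ x in ⋃ i ∈ s, interior (D.cell i), f x := by
        refine (integral_biUnion_finset s (fun i _ => isOpen_interior.measurableSet)
          (fun i _ j _ hij => D.disjoint_elem i j hij) fun i hi => hf.mono_set (hT i hi)).symm
    _ ≤ ∫ x in T, f x :=
        setIntegral_mono_set hf (.of_forall h0) (Set.iUnion₂_subset hT).eventuallyLE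

theorem integrableOn_gradient_sq (hu : u ∈ D.splineSpace k) :
    IntegrableOn (fun x => ‖gradient u x‖ ^ 2) D.region :=
  (memLp_gradient hu).integrable_norm_pow two_ne_zero

theorem sum_cell_le_gradTerm (hu : u ∈ D.splineSpace k) :
    ∑ i ∈ D.active, ∫ x in D.cell i, ‖gradient u x‖ ^ 2 ≤ D.gradTerm u :=
  sum_setIntegral_cell_le (integrableOn_gradient_sq hu) (fun _ => sq_nonneg _)
    fun _ hi => interior_subset.trans (cell_subset_region hi)

theorem integrableOn_cell_of_continuous {f : EuclideanSpace ℝ (Fin d) → ℝ} (hf : Continuous f) :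
    IntegrableOn f (D.cell i) := hf.continuousOn.integrableOn_compact isCompact_cell

theorem IsPiecewise.setIntegral_cell_eq (h : D.IsPiecewise k u P) (hi : i ∈ D.active) :
    ∫ x in D.cell i, ‖gradient u x‖ ^ 2 =
      ∑ a, ∫ x in D.cell i, polyFun (pderiv a (P i)) x ^ 2 := by
  rw [← integral_finsetSum Finset.univ (f := fun a x => polyFun (pderiv a (P i)) x ^ 2) fun a _ =>
    integrableOn_cell_of_continuous ((continuous_polyFun _).pow 2)]
  rw [← setIntegral_interior_cell, ← setIntegral_interior_cell fun x => ∑ a, _]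
  refine setIntegral_congr_fun isOpen_interior.measurableSet fun x hx => ?_
  simp only [h.gradient_eq hi hx, norm_polyGrad_sq]

theorem face_eq_empty (hi : i ∈ D.active) (hcut : ¬ D.IsCut i) : D.face i = ∅ := by
  refine Set.eq_empty_iff_forall_notMem.2 fun x hx => hcut ⟨hi, x, face_subset_cell hx,
    face_subset_frontier hx⟩

theorem nitscheParam_pos {β : ℝ} (hβ : 0 < β) (i : Fin D.n) : 0 < D.nitscheParam β i :=
  mul_pos hβ (inv_pos.2 meshSize_pos)

theorem ghostParam_nonneg {γ : ℝ} (hγ : 0 ≤ γ) (i j : Fin D.n) : 0 ≤ D.ghostParam k γ i j :=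
  mul_nonneg hγ (pow_nonneg interfaceSize_pos.le _)

/-- Since `|n| = 1`, the flux is dominated by the full gradient, whose components are again in `Q_k`
and subject to the trace inequality. Uncut elements have no boundary face. -/
theorem setIntegral_normalDeriv_sq_le {CT : ℝ} (h0 : 0 ≤ CT) (hCT : D.IsTraceConst k CT)
    (hu : u ∈ D.splineSpace k) (hi : i ∈ D.active) :
    ∫ x in D.dirichletFace i, D.normalDeriv u i x ^ 2 ∂(surfaceMeasure d) ≤
      CT * (D.meshSize i)⁻¹ * ∫ x in D.cell i, ‖gradient u x‖ ^ 2 := by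
  obtain ⟨P, hP⟩ := D.exists_isPiecewise hu
  by_cases hcut : D.IsCut i
  · have hint : ∀ a, IntegrableOn (fun x => polyFun (pderiv a (P i)) x ^ 2) (D.face i)
        (surfaceMeasure d) := fun a =>
      ((continuous_polyFun _).continuousOn.memLp_restrict_of_subset_isCompact (p := 2)
        isCompact_cell face_subset_cell isClosed_face.measurableSet
        surfaceMeasure_face_lt_top).integrable_sq
    calc ∫ x in D.dirichletFace i, D.normalDeriv u i x ^ 2 ∂(surfaceMeasure d)
        ≤ ∫ x in D.face i, D.normalDeriv u i x ^ 2 ∂(surfaceMeasure d) :=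
          setIntegral_mono_set (hP.memLp_normalDeriv hi).integrable_sq
            (.of_forall fun _ => sq_nonneg _) dirichletFace_subset_face.eventuallyLE
      _ ≤ ∫ x in D.face i, ∑ a, polyFun (pderiv a (P i)) x ^ 2 ∂(surfaceMeasure d) := by
          refine integral_mono_ae (hP.memLp_normalDeriv hi).integrable_sq
            (integrable_finsetSum _ fun a _ => hint a) ?_
          filter_upwards [IsPiecewise.ae_norm_normal,
            ae_restrict_mem isClosed_face.measurableSet] with x h1 h2
          rw [hP.normalDeriv_eq hi (face_subset_cell h2), ← norm_polyGrad_sq, ← sq_abs]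
          refine pow_le_pow_left₀ (abs_nonneg _) ?_ 2
          simpa [h1] using abs_real_inner_le_norm (polyGrad (P i) x) (D.normal x)
      _ = ∑ a, ∫ x in D.face i, polyFun (pderiv a (P i)) x ^ 2 ∂(surfaceMeasure d) :=
          integral_finsetSum _ fun a _ => hint a
      _ ≤ ∑ a, CT * ∫ x in D.cell i, (D.meshSize i)⁻¹ * polyFun (pderiv a (P i)) x ^ 2 :=
          Finset.sum_le_sum fun a _ => hCT i hcut _ (pderiv_mem_restrictDegree a (hP i hi).1)
      _ = _ := by
          rw [hP.setIntegral_cell_eq hi, Finset.mul_sum]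
          exact Finset.sum_congr rfl fun a _ => by rw [integral_const_mul, mul_assoc]
  · rw [dirichletFace, face_eq_empty hi hcut, Set.empty_inter, Measure.restrict_empty,
      integral_zero_measure]
    exact mul_nonneg (mul_nonneg h0 (inv_nonneg.2 meshSize_pos.le))
      (integral_nonneg fun _ => sq_nonneg _)

/-- The inverse Nitsche weight `h_K / β` cancels the factor `h_K⁻¹` of the trace inequality, leaving
a constant independent of the mesh. -/
theorem fluxTerm_le {CT β : ℝ} (hβ : 0 < β) (h0 : 0 ≤ CT) (hCT : D.IsTraceConst k CT)
    (hu : u ∈ D.splineSpace k) :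
    D.fluxTerm (D.nitscheParam β) u ≤ CT / β * D.gradTerm u := by
  calc D.fluxTerm (D.nitscheParam β) u
      ≤ ∑ i ∈ D.active, CT / β * ∫ x in D.cell i, ‖gradient u x‖ ^ 2 := by
        refine Finset.sum_le_sum fun i hi => ?_
        have hh := (meshSize_pos (D := D) (i := i))
        rw [integral_const_mul]
        refine (mul_le_mul_of_nonneg_left (setIntegral_normalDeriv_sq_le h0 hCT hu hi)
          (inv_nonneg.2 (nitscheParam_pos hβ i).le)).trans_eq ?_
        rw [nitscheParam]
        field_simp
    _ ≤ CT / β * D.gradTerm u := by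
        rw [← Finset.mul_sum]
        exact mul_le_mul_of_nonneg_left (sum_cell_le_gradTerm hu) (div_nonneg h0 hβ.le)

theorem gradTerm_le {CG CF γ : ℝ} (hγ : 0 < γ) (hG : D.IsGhostConst k CG CF)
    (hu : u ∈ D.splineSpace k) :
    D.gradTerm u ≤ CG * D.physTerm u + CF / γ * D.ghostTerm k (D.ghostParam k γ) u := by
  refine (hG u hu).trans_eq ?_
  rw [physTerm, ghostTerm, Finset.mul_sum]
  refine congrArg _ (Finset.sum_congr rfl fun p _ => ?_)
  rw [integral_const_mul, ghostParam]
  field_simp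

/-- The Nitsche form is coercive if the parameters exceed their thresholds. -/
theorem exists_coercive {CT CG CF β γ : ℝ} (hCT : 0 < CT) (hCG : 0 < CG) (hCF : 0 < CF)
    (hβ : CT * CG < β) (hγ : CF / CG ≤ γ) :
    ∃ c > 0, ∀ D : ImmersedMesh d, D.IsTraceConst k CT → D.IsGhostConst k CG CF →
      ∀ u ∈ D.splineSpace k,
        c * D.energyNorm k (D.nitscheParam β) (D.ghostParam k γ) u ^ 2 ≤
          D.form k (D.nitscheParam β) (D.ghostParam k γ) u u := by
  have hβ0 : 0 < β := (mul_pos hCT hCG).trans hβ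
  have hγ0 : 0 < γ := (div_pos hCF hCG).trans_le hγ
  have hCFγ : CF / γ ≤ CG := by
    rw [div_le_iff₀ hCG] at hγ
    rwa [div_le_iff₀ hγ0, mul_comm]
  -- `δ` is the weight in Young's inequality: `CT CG < δ` leaves a positive share of `O + G`, and `δ
  -- < β` a positive share of the trace term.
  obtain ⟨δ, hδ1, hδ2⟩ := exists_between hβ
  have hδ0 : 0 < δ := (mul_pos hCT hCG).trans hδ1
  have hq : 0 < 1 - CT * CG / δ := sub_pos.2 ((div_lt_one hδ0).2 hδ1)
  have hθ : 0 < 1 - δ / β := sub_pos.2 ((div_lt_one hβ0).2 hδ2)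
  -- This constant bounds `A + N + G` by a multiple of `O + G`, with one summand for each term.
  have hM : 0 < CG + CT / β * CG + 1 := by positivity
  refine ⟨min ((1 - CT * CG / δ) / (CG + CT / β * CG + 1)) (1 - δ / β),
    lt_min (div_pos hq hM) hθ, fun D hT hG u hu => ?_⟩
  refine le_trans ?_ (le_form_self (nitscheParam_pos hβ0) hu)
  rw [energyNorm_sq (nitscheParam_pos hβ0) (ghostParam_nonneg hγ0.le)]
  have hN := fluxTerm_le hβ0 hCT.le hT hu
  have hA := gradTerm_le hγ0 hG hu
  have hN0 := fluxTerm_nonneg (D := D) (u := u) (nitscheParam_pos hβ0)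
  have hB0 := traceTerm_nonneg (D := D) (u := u) (nitscheParam_pos hβ0)
  have hG0 := ghostTerm_nonneg (D := D) (k := k) (u := u) (ghostParam_nonneg (k := k) hγ0.le)
  have hΩ0 := physTerm_nonneg (D := D) (u := u)
  generalize D.fluxTerm (D.nitscheParam β) u = N at *
  generalize D.traceTerm (D.nitscheParam β) u = B at *
  generalize D.ghostTerm k (D.ghostParam k γ) u = G at *
  generalize D.gradTerm u = A at *
  generalize D.physTerm u = O at *
  have hA' : A ≤ CG * (O + G) := by
    have := mul_le_mul_of_nonneg_right hCFγ hG0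
    linarith
  have hN' : N ≤ CT / β * CG * (O + G) := by
    rw [mul_assoc]
    exact hN.trans (mul_le_mul_of_nonneg_left hA' (by positivity))
  -- Young's inequality with weights `β / δ` and `δ / β`, after which `N` is replaced by its bound
  -- in terms of `O + G`.
  have hY : 2 * (√N * √B) ≤ CT * CG / δ * (O + G) + δ / β * B := by
    have h1 : 2 * (√N * √B) ≤ β / δ * N + δ / β * B := by
      have h2 : √(β / δ) * √(δ / β) = 1 := by
        rw [← Real.sqrt_mul (by positivity), div_mul_div_cancel₀ hδ0.ne', div_self hβ0.ne',
          Real.sqrt_one]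
      have h3 := two_mul_le_add_sq (√(β / δ) * √N) (√(δ / β) * √B)
      rw [mul_pow, mul_pow, Real.sq_sqrt hN0, Real.sq_sqrt hB0,
        Real.sq_sqrt (div_pos hβ0 hδ0).le, Real.sq_sqrt (div_pos hδ0 hβ0).le] at h3
      calc 2 * (√N * √B) = √(β / δ) * √(δ / β) * (2 * (√N * √B)) := by rw [h2, one_mul]
        _ = 2 * (√(β / δ) * √N) * (√(δ / β) * √B) := by ring
        _ ≤ _ := h3
    have h4 : β / δ * N ≤ CT * CG / δ * (O + G) := by
      refine (mul_le_mul_of_nonneg_left hN' (by positivity)).trans_eq ?_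
      field_simp
    linarith
  set c := min ((1 - CT * CG / δ) / (CG + CT / β * CG + 1)) (1 - δ / β)
  have hc1 : c * (CG + CT / β * CG + 1) ≤ 1 - CT * CG / δ :=
    (le_div_iff₀ hM).1 (min_le_left _ _)
  have hc2 : c ≤ 1 - δ / β := min_le_right _ _
  have hc0 : 0 ≤ c := (lt_min (div_pos hq hM) hθ).le
  calc c * (A + N + B + G)
      ≤ c * ((CG + CT / β * CG + 1) * (O + G) + B) := by
        refine mul_le_mul_of_nonneg_left ?_ hc0
        linarith
    _ = c * (CG + CT / β * CG + 1) * (O + G) + c * B := by ring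
    _ ≤ (1 - CT * CG / δ) * (O + G) + (1 - δ / β) * B :=
        add_le_add (mul_le_mul_of_nonneg_right hc1 (by positivity))
          (mul_le_mul_of_nonneg_right hc2 hB0)
    _ ≤ _ := by linarith

end ImmersedMesh

/-! ### The uniform trace constant -/

namespace ImmersedMesh

variable {d k : ℕ} {D : ImmersedMesh d} {i j : Fin D.n}

theorem meshSize_pow (hd : 1 ≤ d) : D.meshSize i ^ d = volume.real (D.cell i) := by
  rw [meshSize, one_div, Real.rpow_inv_natCast_pow measureReal_nonneg (by omega)]

theorem abs_sub_lower_le {I : BoxIntegral.Box (Fin d)} {x : EuclideanSpace ℝ (Fin d)}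
    (hx : x ∈ closedBox I) (b : Fin d) : |x b - I.lower b| ≤ 1 * (I.upper b - I.lower b) := by
  rw [one_mul, abs_of_nonneg (sub_nonneg.2 (hx b).1)]
  exact sub_le_sub_right (hx b).2 _

/-- The trace constant depends only on the dimension, the degree and the bound for the boundary
faces. -/
theorem exists_isTraceConst (hd : 1 ≤ d) (k : ℕ) (s : ℝ) :
    ∃ CT > 0, ∀ D : ImmersedMesh d,
      (∀ i, D.IsCut i → (surfaceMeasure d).real (D.face i) ≤ s * D.meshSize i ^ (d - 1)) →
      D.IsTraceConst k CT := by
  obtain ⟨C, hC, H⟩ := exists_sq_polyFun_le_integral_closedBox d k 1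
  -- Taking `max s 1` keeps the constant positive for every real `s`.
  refine ⟨max s 1 * C, by positivity, fun D hD i hi φ hφ => ?_⟩
  have hh := meshSize_pos (D := D) (i := i)
  change ∫ x in D.face i, polyFun φ x ^ 2 ∂(surfaceMeasure d) ≤
    max s 1 * C * ∫ x in D.cell i, (D.meshSize i)⁻¹ * polyFun φ x ^ 2
  rw [integral_const_mul]
  set T := ∫ x in D.cell i, polyFun φ x ^ 2 with hT
  have hT0 : 0 ≤ T := integral_nonneg fun _ => sq_nonneg _
  -- The supremum over the face, multiplied by its measure of order `h^(d-1)`, yields the required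
  -- factor `h⁻¹`; how the element is cut plays no role.
  have hsup : ∀ x ∈ D.face i, ‖polyFun φ x ^ 2‖ ≤ C * T / D.meshSize i ^ d := by
    intro x hx
    rw [Real.norm_of_nonneg (sq_nonneg _), le_div_iff₀ (pow_pos hh d), meshSize_pow hd, mul_comm]
    exact (H φ hφ (D.elem i) x (abs_sub_lower_le (face_subset_cell hx))).1
  have h1 := norm_setIntegral_le_of_norm_le_const surfaceMeasure_face_lt_top hsup
  refine (le_abs_self _).trans (h1.trans ?_)
  have h2 : (surfaceMeasure d).real (D.face i) ≤ max s 1 * D.meshSize i ^ (d - 1) :=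
    (hD i hi).trans (mul_le_mul_of_nonneg_right (le_max_left _ _) (pow_nonneg hh.le _))
  refine (mul_le_mul_of_nonneg_left h2 (by positivity)).trans_eq ?_
  obtain ⟨n, rfl⟩ : ∃ n, d = n + 1 := ⟨d - 1, by omega⟩
  rw [Nat.add_sub_cancel, pow_succ]
  field_simp

end ImmersedMesh

/-! ### One-variable Taylor expansion along coordinate lines -/

section Taylor

variable {d : ℕ}

theorem MvPolynomial.iterate_pderiv_eq_zero {σ : Type*} (a : σ) (m : ℕ) (p : MvPolynomial σ ℝ)
    (hp : ∀ s ∈ p.support, s a < m) : (pderiv a)^[m] p = 0 := by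
  classical
  induction m generalizing p with
  | zero =>
    rw [Function.iterate_zero, id_eq, ← support_eq_empty]
    exact Finset.eq_empty_of_forall_notMem fun s hs => (Nat.not_lt_zero _ (hp s hs))
  | succ m ih =>
    rw [Function.iterate_succ_apply]
    refine ih _ fun s hs => ?_
    have hmem : pderiv a p ∈ restrictSupport ℝ {s : σ →₀ ℕ | s a < m} := by
      rw [p.as_sum, map_sum]
      refine Submodule.sum_mem _ fun s hs => ?_
      rw [pderiv_monomial]
      -- Truncated subtraction would not lower a zero exponent; in that case the coefficient of the
      -- derivative vanishes instead.
      rcases Nat.eq_zero_or_pos (s a) with h | h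
      · simp [h]
      · rw [monomial_mem_restrictSupport]
        have := hp s hs
        exact Or.inl (by simp; omega)
    exact (mem_restrictSupport_iff ℝ).1 hmem hs

theorem MvPolynomial.iterate_pderiv_sub {σ : Type*} (a : σ) (m : ℕ) (p q : MvPolynomial σ ℝ) :
    (pderiv a)^[m] (p - q) = (pderiv a)^[m] p - (pderiv a)^[m] q :=
  iterate_map_sub (pderiv a) m p q

theorem MvPolynomial.iterate_pderiv_mem_restrictDegree {σ : Type*} {k : ℕ} (a : σ) (m : ℕ)
    {p : MvPolynomial σ ℝ} (hp : p ∈ restrictDegree σ ℝ k) :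
    (pderiv a)^[m] p ∈ restrictDegree σ ℝ k := by
  induction m with
  | zero => exact hp
  | succ m ih => rw [Function.iterate_succ_apply']; exact pderiv_mem_restrictDegree a ih

theorem hasDerivAt_polyFun_line (p : MvPolynomial (Fin d) ℝ) (x : EuclideanSpace ℝ (Fin d))
    (a : Fin d) (t : ℝ) :
    HasDerivAt (fun t : ℝ => polyFun p (x + t • EuclideanSpace.single a 1))
      (polyFun (pderiv a p) (x + t • EuclideanSpace.single a 1)) t := by
  have h1 : HasDerivAt (fun t : ℝ => x + t • EuclideanSpace.single a (1 : ℝ))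
      (EuclideanSpace.single a (1 : ℝ)) t := by
    simpa using ((hasDerivAt_id t).smul_const (EuclideanSpace.single a (1 : ℝ))).const_add x
  have h2 := (hasFDerivAt_polyFun p (x + t • EuclideanSpace.single a 1)).comp_hasDerivAt t h1
  simpa using! h2

theorem iteratedDeriv_polyFun_line (p : MvPolynomial (Fin d) ℝ) (x : EuclideanSpace ℝ (Fin d))
    (a : Fin d) (m : ℕ) :
    iteratedDeriv m (fun t : ℝ => polyFun p (x + t • EuclideanSpace.single a 1)) =
      fun t : ℝ => polyFun ((pderiv a)^[m] p) (x + t • EuclideanSpace.single a 1) := by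
  induction m with
  | zero => simp
  | succ m ih =>
    ext t
    rw [iteratedDeriv_succ, ih, (hasDerivAt_polyFun_line _ x a t).deriv,
      Function.iterate_succ_apply']

/-- A polynomial of degree at most `k` in one variable whose derivatives of order less than `k`
in this variable vanish at a point is a multiple of a power along the line through this point. -/
theorem polyFun_line_eq (a : Fin d) (k : ℕ) (p : MvPolynomial (Fin d) ℝ)
    (hp : (pderiv a)^[k + 1] p = 0) (x : EuclideanSpace ℝ (Fin d))
    (hx : ∀ m < k, polyFun ((pderiv a)^[m] p) x = 0) (t : ℝ) :
    polyFun p (x + t • EuclideanSpace.single a 1) =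
      t ^ k / k.factorial * polyFun ((pderiv a)^[k] p) x := by
  induction k generalizing p t with
  | zero =>
    have hd : ∀ t : ℝ, HasDerivAt
        (fun t : ℝ => polyFun p (x + t • EuclideanSpace.single a 1)) 0 t := by
      intro t
      have h := hasDerivAt_polyFun_line p x a t
      simp only [zero_add, Function.iterate_one] at hp
      simpa [hp, polyFun] using h
    have := is_const_of_deriv_eq_zero (fun t => (hd t).differentiableAt) (fun t => (hd t).deriv) t 0
    simpa using this
  | succ k ih =>
    have h0 : polyFun p x = 0 := hx 0 k.succ_pos
    have ih' := ih (pderiv a p) (by rw [← Function.iterate_succ_apply]; exact hp)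
      (fun m hm => by rw [← Function.iterate_succ_apply]; exact hx (m + 1) (by omega))
    rw [← Function.iterate_succ_apply] at ih'
    set J := polyFun ((pderiv a)^[k + 1] p) x
    -- By the induction hypothesis for `pderiv a p`, the polynomial and the claimed monomial have
    -- the same derivative along the line; both vanish at `t = 0`.
    have hd : ∀ t : ℝ, HasDerivAt
        (fun t : ℝ => polyFun p (x + t • EuclideanSpace.single a 1) -
          t ^ (k + 1) / (k + 1).factorial * J) 0 t := by
      intro t
      have h1 := hasDerivAt_polyFun_line p x a t
      have h2 := (((hasDerivAt_pow (k + 1) t).div_const ((k + 1).factorial : ℝ)).mul_const J)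
      convert! h1.sub h2 using 1
      rw [ih', Nat.factorial_succ]
      push_cast
      have : (k.factorial : ℝ) ≠ 0 := by positivity
      field_simp
      simp
    have := is_const_of_deriv_eq_zero (fun t => (hd t).differentiableAt) (fun t => (hd t).deriv) t 0
    simp [h0] at this
    linarith

/-- If a function that is `m` times continuously differentiable near `0` agrees with two smooth
functions on the two sides of `0`, then the derivatives of these at `0` agree up to order `m`. -/
theorem iteratedDeriv_eq_of_eqOn {m : ℕ} {f g₁ g₂ : ℝ → ℝ} {δ₁ δ₂ : ℝ} (h₁ : 0 < δ₁) (h₂ : 0 < δ₂)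
    (hf : ContDiffOn ℝ m f (Set.Icc (-δ₁) δ₂)) (hg₁ : ContDiff ℝ m g₁) (hg₂ : ContDiff ℝ m g₂)
    (hfg₁ : Set.EqOn f g₁ (Set.Icc (-δ₁) 0)) (hfg₂ : Set.EqOn f g₂ (Set.Icc 0 δ₂)) :
    iteratedDeriv m g₁ 0 = iteratedDeriv m g₂ 0 := by
  have hf0 : ContDiffAt ℝ m f 0 := hf.contDiffAt (Icc_mem_nhds (by linarith) h₂)
  -- At an endpoint of a nondegenerate interval the derivatives within it are still unique, so
  -- agreement on one side determines those of `f` at `0`.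
  have key : ∀ {g : ℝ → ℝ} {l r : ℝ}, l < r → (0 : ℝ) ∈ Set.Icc l r → ContDiff ℝ m g →
      Set.EqOn f g (Set.Icc l r) → iteratedDeriv m f 0 = iteratedDeriv m g 0 := by
    intro g l r hlr h0 hg hfg
    rw [← iteratedDerivWithin_eq_iteratedDeriv (uniqueDiffOn_Icc hlr) hf0 h0,
      ← iteratedDerivWithin_eq_iteratedDeriv (uniqueDiffOn_Icc hlr) hg.contDiffAt h0,
      iteratedDerivWithin_congr hfg h0]
  rw [← key (by linarith) ⟨by linarith, le_rfl⟩ hg₁ hfg₁, key h₂ ⟨le_rfl, h₂.le⟩ hg₂ hfg₂]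

end Taylor

/-! ### Geometry of the interface of two adjacent boxes -/

namespace ImmersedMesh

section

variable {d : ℕ} {D : ImmersedMesh d} {i j : Fin D.n}

theorem interface_comm (i j : Fin D.n) : D.interface i j = D.interface j i := Set.inter_comm _ _

theorem interfaceSize_comm (i j : Fin D.n) : D.interfaceSize i j = D.interfaceSize j i :=
  max_comm _ _

theorem interfaceNormal_comm (i j : Fin D.n) : D.interfaceNormal i j = D.interfaceNormal j i := by
  simp only [interfaceNormal, or_comm]

/-- The chosen normal does not depend on the order of the two elements, so swapping them only flips
the sign of the jump. -/
theorem jump_sq_comm (k : ℕ) (u : EuclideanSpace ℝ (Fin d) → ℝ) (i j : Fin D.n)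
    (x : EuclideanSpace ℝ (Fin d)) : D.jump k u i j x ^ 2 = D.jump k u j i x ^ 2 := by
  rw [jump, jump, interfaceNormal_comm]
  ring

theorem Adjacent.symm (h : D.Adjacent i j) : D.Adjacent j i :=
  ⟨h.2.1, h.1, h.2.2.1.symm, by rw [interface_comm]; exact h.2.2.2⟩

end

variable {n : ℕ} {D : ImmersedMesh (n + 1)} {i j : Fin D.n}

/-- The interface of two adjacent elements is a box in a hyperplane orthogonal to a coordinate
direction, which is the direction in which the two elements touch. -/
theorem Adjacent.exists_box (h : D.Adjacent i j) :
    ∃ (a : Fin (n + 1)) (c : ℝ) (I : BoxIntegral.Box (Fin n)),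
      ((D.elem i).upper a = c ∧ (D.elem j).lower a = c ∨
        (D.elem j).upper a = c ∧ (D.elem i).lower a = c) ∧
      D.interface i j ⊆ {x | x a = c} ∧
      hyperplaneEmb a c ⁻¹' D.interface i j = closedBox I ∧
      (∀ b, I.lower b = max ((D.elem i).lower (a.succAbove b)) ((D.elem j).lower (a.succAbove b))) ∧
      (∀ b, I.upper b = min ((D.elem i).upper (a.succAbove b)) ((D.elem j).upper (a.succAbove b))) ∧
      D.interfaceNormal i j = EuclideanSpace.single a 1 := by
  obtain ⟨hi, hj, hij, hF⟩ := h
  set A := D.elem i with hA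
  set B := D.elem j with hB
  have hcell : ∀ x ∈ D.interface i j, ∀ b, max (A.lower b) (B.lower b) ≤ x b ∧
      x b ≤ min (A.upper b) (B.upper b) := fun x hx b =>
    ⟨max_le (interface_subset_cell_left hx b).1 (interface_subset_cell_right hx b).1,
      le_min (interface_subset_cell_left hx b).2 (interface_subset_cell_right hx b).2⟩
  obtain ⟨x₀, hx₀⟩ : (D.interface i j).Nonempty := by
    by_contra h
    rw [Set.not_nonempty_iff_eq_empty] at h
    exact hF (by rw [h]; exact measure_empty)
  -- If the boxes overlapped with positive length in every coordinate, the midpoint of the overlap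
  -- would lie in both interiors.
  obtain ⟨a, ha⟩ : ∃ a, min (A.upper a) (B.upper a) ≤ max (A.lower a) (B.lower a) := by
    by_contra! hlt
    have hmem : ∀ b, (max (A.lower b) (B.lower b) + min (A.upper b) (B.upper b)) / 2 ∈
        Set.Ioo (max (A.lower b) (B.lower b)) (min (A.upper b) (B.upper b)) := fun b => by
      have := hlt b
      constructor <;> linarith
    refine (Set.disjoint_left.1 (D.disjoint_elem i j hij))
      (a := WithLp.toLp 2 fun b => (max (A.lower b) (B.lower b) + min (A.upper b) (B.upper b)) / 2)
      ?_ ?_ <;> rw [interior_closedBox] <;> intro b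
    · exact ⟨(le_max_left _ _).trans_lt (hmem b).1, (hmem b).2.trans_le (min_le_left _ _)⟩
    · exact ⟨(le_max_right _ _).trans_lt (hmem b).1, (hmem b).2.trans_le (min_le_right _ _)⟩
  have hAa := A.lower_lt_upper a
  have hBa := B.lower_lt_upper a
  obtain ⟨c, hc⟩ : ∃ c, A.upper a = c ∧ B.lower a = c ∨ B.upper a = c ∧ A.lower a = c := by
    have h1 := (hcell x₀ hx₀ a).1.trans (hcell x₀ hx₀ a).2
    have h2 := le_antisymm ha h1
    rcases le_total (A.upper a) (B.upper a) with h | h <;>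
      rcases le_total (A.lower a) (B.lower a) with h' | h' <;>
      simp only [min_eq_left, min_eq_right, max_eq_left, max_eq_right, h, h'] at h2
    · exact ⟨A.upper a, Or.inl ⟨rfl, h2.symm⟩⟩
    · linarith
    · linarith
    · exact ⟨B.upper a, Or.inr ⟨rfl, h2.symm⟩⟩
  have hplane : D.interface i j ⊆ {x | x a = c} := by
    intro x hx
    have h1 := interface_subset_cell_left hx a
    have h2 := interface_subset_cell_right hx a
    simp only [Set.mem_Icc, ← hA, ← hB] at h1 h2
    rcases hc with ⟨e1, e2⟩ | ⟨e1, e2⟩ <;> simp only [Set.mem_ofPred_eq] <;> linarith [h1.1, h1.2, h2.1, h2.2]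
  -- A degenerate tangential overlap would make the interface a null set of the hyperplane.
  have hpos : ∀ b : Fin n, max (A.lower (a.succAbove b)) (B.lower (a.succAbove b)) <
      min (A.upper (a.succAbove b)) (B.upper (a.succAbove b)) := by
    intro b
    by_contra! hb
    refine hF ?_
    rw [surfaceMeasure_eq_volume_preimage hplane]
    have hvol : volume ((EuclideanSpace.equiv (Fin n) ℝ) ⁻¹' Set.Icc
        (fun b => max (A.lower (a.succAbove b)) (B.lower (a.succAbove b)))
        (fun b => min (A.upper (a.succAbove b)) (B.upper (a.succAbove b)))) = 0 := by
      have h := (EuclideanSpace.volume_preserving_symm_measurableEquiv_toLp (Fin n))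
      refine (h.measure_preimage_equiv _).trans ?_
      rw [Real.volume_Icc_pi]
      exact Finset.prod_eq_zero (Finset.mem_univ b) (ENNReal.ofReal_eq_zero.2 (by linarith))
    refine measure_mono_null (fun y hy => ?_) hvol
    have := fun b => hcell _ hy (a.succAbove b)
    simp only [hyperplaneEmb, Fin.insertNth_apply_succAbove] at this
    exact ⟨fun b => (this b).1, fun b => (this b).2⟩
  refine ⟨a, c, ⟨_, _, hpos⟩, hc, hplane, ?_, fun b => rfl, fun b => rfl, ?_⟩
  · ext y
    constructor
    · intro hy b
      have := hcell _ hy (a.succAbove b)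
      simpa only [hyperplaneEmb, Fin.insertNth_apply_succAbove, Set.mem_Icc] using this
    · intro hy
      have hmem : ∀ b, max (A.lower b) (B.lower b) ≤ hyperplaneEmb a c y b ∧
          hyperplaneEmb a c y b ≤ min (A.upper b) (B.upper b) := by
        intro b
        refine Fin.succAboveCases a ?_ (fun b => ?_) b
        · simp only [hyperplaneEmb, Fin.insertNth_apply_same]
          rcases hc with ⟨e1, e2⟩ | ⟨e1, e2⟩
          · exact ⟨max_le (by linarith) e2.le, le_min e1.ge (by linarith)⟩
          · exact ⟨max_le e2.le (by linarith), le_min (by linarith) e1.ge⟩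
        · simpa only [hyperplaneEmb, Fin.insertNth_apply_succAbove, Set.mem_Icc] using hy b
      have hval : hyperplaneEmb a c y a = c := by simp [hyperplaneEmb]
      refine ⟨⟨subset_closure fun b => ⟨(le_max_left _ _).trans (hmem b).1,
        (hmem b).2.trans (min_le_left _ _)⟩, fun hint => ?_⟩,
        ⟨subset_closure fun b => ⟨(le_max_right _ _).trans (hmem b).1,
        (hmem b).2.trans (min_le_right _ _)⟩, fun hint => ?_⟩⟩
      · rw [cell, interior_closedBox] at hint
        have := hint a
        rw [hval, ← hA] at this
        rcases hc with ⟨e1, e2⟩ | ⟨e1, e2⟩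
        · exact this.2.ne' e1
        · exact this.1.ne e2
      · rw [cell, interior_closedBox] at hint
        have := hint a
        rw [hval, ← hB] at this
        rcases hc with ⟨e1, e2⟩ | ⟨e1, e2⟩
        · exact this.1.ne e2
        · exact this.2.ne' e1
  · have hex : ∃ a, A.upper a = B.lower a ∨ B.upper a = A.lower a :=
      ⟨a, hc.imp (fun h => h.1.trans h.2.symm) fun h => h.1.trans h.2.symm⟩
    rw [interfaceNormal, dif_pos hex]
    have hspec := hex.choose_spec
    -- Touching in any other coordinate is excluded by the positive tangential overlap, so the
    -- arbitrary choice is forced.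
    suffices hex.choose = a by rw [this]
    by_contra hne
    obtain ⟨b, hb⟩ := Fin.exists_succAbove_eq hne
    rw [← hb] at hspec
    have := hpos b
    rw [max_lt_iff, lt_min_iff, lt_min_iff] at this
    rcases hspec with h | h
    · exact this.2.1.ne h.symm
    · exact this.1.2.ne h.symm

end ImmersedMesh

/-! ### The difference of neighbouring pieces equals a power times the jump -/

namespace ImmersedMesh

section

variable {d k : ℕ} {D : ImmersedMesh d} {u : EuclideanSpace ℝ (Fin d) → ℝ}
  {P : Fin D.n → MvPolynomial (Fin d) ℝ} {i j : Fin D.n}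

theorem add_smul_single_mem_cell {x : EuclideanSpace ℝ (Fin d)} {a : Fin d} {t : ℝ}
    (hx : x ∈ D.cell i) (ht : x a + t ∈ Set.Icc ((D.elem i).lower a) ((D.elem i).upper a)) :
    x + t • EuclideanSpace.single a 1 ∈ D.cell i := by
  intro b
  rcases eq_or_ne b a with rfl | h
  · simpa using ht
  · simpa [h] using hx b

/-- Across an interface orthogonal to a coordinate direction, the derivatives in this direction of
the polynomial pieces of a spline agree up to order `k - 1`. -/
theorem IsPiecewise.polyFun_iterate_pderiv_eq (hu : u ∈ D.splineSpace k)
    (h : D.IsPiecewise k u P) (hi : i ∈ D.active) (hj : j ∈ D.active) {a : Fin d}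
    {x : EuclideanSpace ℝ (Fin d)} (hxi : x ∈ D.cell i) (hxj : x ∈ D.cell j)
    (hai : (D.elem i).upper a = x a) (haj : (D.elem j).lower a = x a) {m : ℕ} (hm : m < k) :
    polyFun ((pderiv a)^[m] (P i)) x = polyFun ((pderiv a)^[m] (P j)) x := by
  have h1 : 0 < (D.elem i).upper a - (D.elem i).lower a :=
    sub_pos.2 ((D.elem i).lower_lt_upper a)
  have h2 : 0 < (D.elem j).upper a - (D.elem j).lower a :=
    sub_pos.2 ((D.elem j).lower_lt_upper a)
  have hl : ∀ t ∈ Set.Icc (-((D.elem i).upper a - (D.elem i).lower a)) 0,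
      x + t • EuclideanSpace.single a (1 : ℝ) ∈ D.cell i := fun t ht =>
    add_smul_single_mem_cell hxi ⟨by linarith [ht.1], by linarith [ht.2]⟩
  have hr : ∀ t ∈ Set.Icc 0 ((D.elem j).upper a - (D.elem j).lower a),
      x + t • EuclideanSpace.single a (1 : ℝ) ∈ D.cell j := fun t ht =>
    add_smul_single_mem_cell hxj ⟨by linarith [ht.1], by linarith [ht.2]⟩
  have hline : ∀ {n : WithTop ℕ∞}, ContDiff ℝ n
      (fun t : ℝ => x + t • EuclideanSpace.single a (1 : ℝ)) := by
    intro n; fun_prop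
  -- The normal segment through `x` runs from one element into the other inside the region, where
  -- `u` is of class `C^(k-1)`; this suffices because `m < k`.
  have hf : ContDiffOn ℝ m (fun t : ℝ => u (x + t • EuclideanSpace.single a 1))
      (Set.Icc (-((D.elem i).upper a - (D.elem i).lower a))
        ((D.elem j).upper a - (D.elem j).lower a)) := by
    refine (hu.1.of_le (by exact_mod_cast Nat.le_sub_one_of_lt hm)).comp hline.contDiffOn ?_
    intro t ht
    rcases le_total t 0 with h0 | h0
    · exact cell_subset_region hi (hl t ⟨ht.1, h0⟩)
    · exact cell_subset_region hj (hr t ⟨h0, ht.2⟩)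
  have := iteratedDeriv_eq_of_eqOn h1 h2 hf ((contDiff_polyFun (P i)).comp hline)
    ((contDiff_polyFun (P j)).comp hline) (fun t ht => (h i hi).2 (hl t ht))
    (fun t ht => (h j hj).2 (hr t ht))
  have e := fun p => congrFun (iteratedDeriv_polyFun_line p x a m) 0
  simp only [zero_smul, add_zero] at e
  rw [← e, ← e]
  exact this

end

variable {n k : ℕ} {D : ImmersedMesh (n + 1)} {u : EuclideanSpace ℝ (Fin (n + 1)) → ℝ}
  {P : Fin D.n → MvPolynomial (Fin (n + 1)) ℝ} {i j : Fin D.n}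
  {a : Fin (n + 1)} {c : ℝ} {I : BoxIntegral.Box (Fin n)}

theorem IsPiecewise.jump_hyperplaneEmb (h : D.IsPiecewise k u P) (hi : i ∈ D.active)
    (hj : j ∈ D.active) (hpre : hyperplaneEmb a c ⁻¹' D.interface i j = closedBox I)
    (hN : D.interfaceNormal i j = EuclideanSpace.single a 1) {y : EuclideanSpace ℝ (Fin n)}
    (hy : y ∈ closedBox I) :
    D.jump k u i j (hyperplaneEmb a c y) =
      polyFun (slice a c ((pderiv a)^[k] (P i - P j))) y := by
  rw [← hpre] at hy
  rw [h.jump_eq hi hj hy, hN, iteratedFDeriv_polyFun_single, iteratedFDeriv_polyFun_single,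
    ← polyFun_sub, ← iterate_pderiv_sub, polyFun_hyperplaneEmb]

/-- The heart of the ghost estimate. Smoothness removes the normal Taylor terms below order `k` and
the degree bound removes those above, so only the term with the jump remains. -/
theorem IsPiecewise.polyFun_sub_eq (hu : u ∈ D.splineSpace k) (h : D.IsPiecewise k u P)
    (hi : i ∈ D.active) (hj : j ∈ D.active)
    (hc : (D.elem i).upper a = c ∧ (D.elem j).lower a = c ∨
      (D.elem j).upper a = c ∧ (D.elem i).lower a = c)
    (hpre : hyperplaneEmb a c ⁻¹' D.interface i j = closedBox I)
    (x : EuclideanSpace ℝ (Fin (n + 1))) :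
    polyFun (P i - P j) x = (x a - c) ^ k / k.factorial *
      polyFun (slice a c ((pderiv a)^[k] (P i - P j)))
        (WithLp.toLp 2 fun b => x (a.succAbove b)) := by
  set y : EuclideanSpace ℝ (Fin n) := WithLp.toLp 2 fun b => x (a.succAbove b) with hy
  -- The derivatives agree on the interface only, but a polynomial vanishing on a nondegenerate box
  -- is zero, so they agree on the whole hyperplane and the identity holds at every `x`.
  have hzero : ∀ m < k, slice a c ((pderiv a)^[m] (P i - P j)) = 0 := by
    intro m hm
    refine MvPolynomial.funext_set (fun b => Set.Icc (I.lower b) (I.upper b))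
      (fun b => Set.Icc_infinite (I.lower_lt_upper b)) fun z hz => ?_
    have hz' : hyperplaneEmb a c (WithLp.toLp 2 z) ∈ D.interface i j := by
      change WithLp.toLp 2 z ∈ hyperplaneEmb a c ⁻¹' D.interface i j
      rw [hpre]
      exact fun b => hz b trivial
    have hval : hyperplaneEmb a c (WithLp.toLp 2 z) a = c := by simp [hyperplaneEmb]
    have hxi := interface_subset_cell_left hz'
    have hxj := interface_subset_cell_right hz'
    rw [map_zero]
    change polyFun (slice a c _) (WithLp.toLp 2 z) = 0
    rw [← polyFun_hyperplaneEmb, iterate_pderiv_sub, polyFun_sub, sub_eq_zero]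
    rcases hc with ⟨e1, e2⟩ | ⟨e1, e2⟩
    · exact h.polyFun_iterate_pderiv_eq hu hi hj hxi hxj (e1.trans hval.symm)
        (e2.trans hval.symm) hm
    · exact (h.polyFun_iterate_pderiv_eq hu hj hi hxj hxi (e1.trans hval.symm)
        (e2.trans hval.symm) hm).symm
  have hx : x = hyperplaneEmb a c y + (x a - c) • EuclideanSpace.single a 1 := by
    ext b
    refine Fin.succAboveCases a ?_ (fun b => ?_) b
    · simp [hyperplaneEmb]
    · simp [hyperplaneEmb, hy]
  have hdeg : (pderiv a)^[k + 1] (P i - P j) = 0 := by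
    refine iterate_pderiv_eq_zero a _ _ fun s hs => Nat.lt_succ_of_le ?_
    exact (mem_restrictDegree _ _ _).1 (Submodule.sub_mem _ (h i hi).1 (h j hj).1) s hs a
  have := polyFun_line_eq a k (P i - P j) hdeg (hyperplaneEmb a c y) (fun m hm => by
    rw [polyFun_hyperplaneEmb, hzero m hm]; simp [polyFun]) (x a - c)
  rw [← hx, polyFun_hyperplaneEmb] at this
  exact this

end ImmersedMesh

/-! ### Shape regularity, comparison of neighbours and inverse estimates -/

/-- Used in reverse: a box with large volume and bounded edges has no short edge. -/
theorem volume_real_closedBox_le_edge_mul {m : ℕ} (I : BoxIntegral.Box (Fin (m + 1))) {M : ℝ}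
    (hM : ∀ b, I.upper b - I.lower b ≤ M) (b : Fin (m + 1)) :
    volume.real (closedBox I) ≤ (I.upper b - I.lower b) * M ^ m := by
  have hpos : ∀ b, 0 ≤ I.upper b - I.lower b := fun b => (sub_pos.2 (I.lower_lt_upper b)).le
  rw [volume_real_closedBox, Fin.prod_univ_succAbove _ b]
  refine mul_le_mul_of_nonneg_left ?_ (hpos b)
  exact (Finset.prod_le_prod (fun c _ => hpos _) fun c _ => hM _).trans_eq (by simp)

namespace ImmersedMesh

variable {n k : ℕ} {σ : ℝ}

theorem setIntegral_cell_le {d : ℕ} {D : ImmersedMesh d} {i : Fin D.n}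
    {f : EuclideanSpace ℝ (Fin d) → ℝ} (hf : Continuous f) {M : ℝ}
    (h : ∀ x ∈ D.cell i, f x ≤ M) : ∫ x in D.cell i, f x ≤ volume.real (D.cell i) * M := by
  refine (setIntegral_mono_on (integrableOn_cell_of_continuous hf)
    (integrableOn_const isCompact_cell.measure_lt_top.ne) measurableSet_cell h).trans_eq ?_
  rw [setIntegral_const, smul_eq_mul]

section

variable {D : ImmersedMesh (n + 1)} {i j : Fin D.n}

theorem IsQuasiUniform.meshSize_le_edge (hD : D.IsQuasiUniform σ) (hi : i ∈ D.active)
    (b : Fin (n + 1)) :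
    D.meshSize i ≤ σ ^ n * ((D.elem i).upper b - (D.elem i).lower b) := by
  have hh := meshSize_pos (D := D) (i := i)
  have h1 := volume_real_closedBox_le_edge_mul (D.elem i) (hD.aspect i hi) b
  rw [← cell, ← meshSize_pow (by omega), mul_pow, pow_succ] at h1
  refine le_of_mul_le_mul_left ?_ (pow_pos hh n)
  linarith

/-- Pass through a common point of the two elements: the two steps have length at most `σ h_i ≤ σ²
h_j` and `σ h_j`, and `h_j` is at most `σ^n` times any edge of element `j`. -/
theorem Adjacent.abs_sub_lower_le (hσ : 1 ≤ σ) (hD : D.IsQuasiUniform σ) (h : D.Adjacent i j)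
    {x : EuclideanSpace ℝ (Fin (n + 1))} (hx : x ∈ D.cell i) (b : Fin (n + 1)) :
    |x b - (D.elem j).lower b| ≤
      (σ ^ 2 + σ) * σ ^ n * ((D.elem j).upper b - (D.elem j).lower b) := by
  obtain ⟨y, hy⟩ : (D.interface i j).Nonempty := by
    by_contra h'
    rw [Set.not_nonempty_iff_eq_empty] at h'
    exact h.2.2.2 (by rw [h']; exact measure_empty)
  have hyi := interface_subset_cell_left hy b
  have hyj := interface_subset_cell_right hy b
  have hxb := hx b
  have h1 : |x b - y b| ≤ σ * D.meshSize i := by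
    refine le_trans ?_ (hD.aspect i h.1 b)
    rw [abs_le]
    constructor <;> linarith [hxb.1, hxb.2, hyi.1, hyi.2]
  have h2 : |y b - (D.elem j).lower b| ≤ σ * D.meshSize j := by
    refine le_trans ?_ (hD.aspect j h.2.1 b)
    rw [abs_le]
    constructor <;> linarith [hyj.1, hyj.2]
  calc |x b - (D.elem j).lower b| ≤ |x b - y b| + |y b - (D.elem j).lower b| := abs_sub_le _ _ _
    _ ≤ σ * (σ * D.meshSize j) + σ * D.meshSize j :=
        add_le_add (h1.trans (mul_le_mul_of_nonneg_left (hD.grading i j h) (by linarith))) h2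
    _ = (σ ^ 2 + σ) * D.meshSize j := by ring
    _ ≤ (σ ^ 2 + σ) * (σ ^ n * ((D.elem j).upper b - (D.elem j).lower b)) :=
        mul_le_mul_of_nonneg_left (hD.meshSize_le_edge h.2.1 b) (by positivity)
    _ = _ := by ring

theorem Adjacent.volume_le (hD : D.IsQuasiUniform σ) (h : D.Adjacent i j) :
    volume.real (D.cell i) ≤ σ ^ (n + 1) * volume.real (D.cell j) := by
  rw [← meshSize_pow (by omega), ← meshSize_pow (by omega), ← mul_pow]
  exact pow_le_pow_left₀ meshSize_pos.le (hD.grading i j h) _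

end

/-- The `L²` norm of a polynomial on an element is bounded by the one on an adjacent element. -/
theorem exists_setIntegral_cell_le_adjacent (n k : ℕ) {σ : ℝ} (hσ : 1 ≤ σ) :
    ∃ C > 0, ∀ D : ImmersedMesh (n + 1), D.IsQuasiUniform σ → ∀ i j, D.Adjacent i j →
      ∀ p ∈ restrictDegree (Fin (n + 1)) ℝ k,
        ∫ x in D.cell i, polyFun p x ^ 2 ≤ C * ∫ x in D.cell j, polyFun p x ^ 2 := by
  obtain ⟨C, hC, H⟩ :=
    exists_sq_polyFun_le_integral_closedBox (n + 1) k ((σ ^ 2 + σ) * σ ^ n)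
  refine ⟨σ ^ (n + 1) * C, by positivity, fun D hD i j h p hp => ?_⟩
  set T := ∫ x in D.cell j, polyFun p x ^ 2
  have hT : 0 ≤ T := integral_nonneg fun _ => sq_nonneg _
  have hv : 0 < volume.real (D.cell j) := volume_real_closedBox_pos _
  refine (setIntegral_cell_le ((continuous_polyFun p).pow 2)
    (M := C * T / volume.real (D.cell j)) fun x hx => ?_).trans ?_
  · rw [le_div_iff₀ hv, mul_comm]
    exact (H p hp (D.elem j) x (h.abs_sub_lower_le hσ hD hx)).1
  · refine (mul_le_mul_of_nonneg_right (h.volume_le hD) (by positivity)).trans_eq ?_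
    field_simp

/-- An inverse estimate: a pointwise bound for a polynomial on an element bounds the `L²` norm of
its derivatives. -/
theorem exists_setIntegral_cell_pderiv_sq_le (n k : ℕ) {σ : ℝ} (hσ : 1 ≤ σ) :
    ∃ C > 0, ∀ D : ImmersedMesh (n + 1), D.IsQuasiUniform σ → ∀ i ∈ D.active,
      ∀ p ∈ restrictDegree (Fin (n + 1)) ℝ k, ∀ M : ℝ, (∀ x ∈ D.cell i, polyFun p x ^ 2 ≤ M) →
        ∀ b, D.meshSize i ^ 2 * ∫ x in D.cell i, polyFun (pderiv b p) x ^ 2 ≤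
          C * D.meshSize i ^ (n + 1) * M := by
  obtain ⟨C, hC, H⟩ := exists_sq_polyFun_le_integral_closedBox (n + 1) k 1
  refine ⟨(σ ^ n) ^ 2 * C, by positivity, fun D hD i hi p hp M hM b => ?_⟩
  have hh := meshSize_pos (D := D) (i := i)
  have hv : 0 < volume.real (D.cell i) := volume_real_closedBox_pos _
  rw [← integral_const_mul]
  refine (setIntegral_cell_le (((continuous_polyFun (pderiv b p)).pow 2).const_mul _)
    (M := (σ ^ n) ^ 2 * C * M) fun x hx => ?_).trans_eq ?_
  · have h1 := (H p hp (D.elem i) x (abs_sub_lower_le hx)).2 b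
    have h2 := h1.trans (mul_le_mul_of_nonneg_left
      (setIntegral_cell_le ((continuous_polyFun p).pow 2) hM) hC.le)
    -- The volume from integrating the bound `M` cancels the one in the scaled pointwise estimate.
    have h3 : (((D.elem i).upper b - (D.elem i).lower b) * polyFun (pderiv b p) x) ^ 2 ≤ C * M := by
      refine le_of_mul_le_mul_left (h2.trans_eq ?_) hv
      exact mul_left_comm _ _ _
    have h4 := pow_le_pow_left₀ hh.le (hD.meshSize_le_edge hi b) 2
    calc D.meshSize i ^ 2 * polyFun (pderiv b p) x ^ 2
        ≤ (σ ^ n * ((D.elem i).upper b - (D.elem i).lower b)) ^ 2 *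
            polyFun (pderiv b p) x ^ 2 := mul_le_mul_of_nonneg_right h4 (sq_nonneg _)
      _ = (σ ^ n) ^ 2 *
          (((D.elem i).upper b - (D.elem i).lower b) * polyFun (pderiv b p) x) ^ 2 := by ring
      _ ≤ (σ ^ n) ^ 2 * (C * M) := mul_le_mul_of_nonneg_left h3 (sq_nonneg _)
      _ = _ := by ring
  · rw [← meshSize_pow (by omega)]
    ring

section

variable {D : ImmersedMesh (n + 1)} {i j : Fin D.n} {s : ℝ} {N : ℕ}
  {a : Fin (n + 1)} {c : ℝ} {I : BoxIntegral.Box (Fin n)}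

theorem IsRegular.meshSize_pow_le_volume (hσ : 1 ≤ σ) (hD : D.IsRegular s σ N)
    (h : D.Adjacent i j) (hplane : D.interface i j ⊆ {x | x a = c})
    (hpre : hyperplaneEmb a c ⁻¹' D.interface i j = closedBox I) :
    D.meshSize i ^ n ≤ σ ^ (n + 1) * volume.real (closedBox I) := by
  have h1 := hD.interface_large i j h
  rw [measureReal_def, surfaceMeasure_eq_volume_preimage hplane, hpre, ← measureReal_def,
    Nat.add_sub_cancel] at h1
  have h2 : D.meshSize i ≤ σ * min (D.meshSize i) (D.meshSize j) := by
    rw [mul_min_of_nonneg _ _ (by linarith : (0 : ℝ) ≤ σ)]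
    exact le_min (le_mul_of_one_le_left meshSize_pos.le hσ) (hD.grading i j h)
  calc D.meshSize i ^ n ≤ (σ * min (D.meshSize i) (D.meshSize j)) ^ n :=
        pow_le_pow_left₀ meshSize_pos.le h2 n
    _ = σ ^ n * min (D.meshSize i) (D.meshSize j) ^ n := mul_pow _ _ _
    _ ≤ σ ^ n * (σ * volume.real (closedBox I)) := mul_le_mul_of_nonneg_left h1 (by positivity)
    _ = _ := by ring

/-- Because the interface has measure comparable to `h_i^n` and edges at most `σ h_i`, each of its
edges is comparable to `h_i`. So the projection of the whole element stays within a bounded multiple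
of the interface, and estimates for the jump polynomial extend to it. -/
theorem IsRegular.abs_sub_lower_interface_le (hσ : 1 ≤ σ) (hD : D.IsRegular s σ N)
    (h : D.Adjacent i j) (hplane : D.interface i j ⊆ {x | x a = c})
    (hpre : hyperplaneEmb a c ⁻¹' D.interface i j = closedBox I)
    (hl : ∀ b, I.lower b =
      max ((D.elem i).lower (a.succAbove b)) ((D.elem j).lower (a.succAbove b)))
    (hu : ∀ b, I.upper b =
      min ((D.elem i).upper (a.succAbove b)) ((D.elem j).upper (a.succAbove b)))
    {x : EuclideanSpace ℝ (Fin (n + 1))} (hx : x ∈ D.cell i) (b : Fin n) :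
    |x (a.succAbove b) - I.lower b| ≤ σ ^ (2 * n + 1) * (I.upper b - I.lower b) := by
  have hh := meshSize_pos (D := D) (i := i)
  have hedge : ∀ b, I.upper b - I.lower b ≤ σ * D.meshSize i := by
    intro b
    refine le_trans ?_ (hD.aspect i h.1 (a.succAbove b))
    rw [hl, hu]
    exact sub_le_sub (min_le_left _ _) (le_max_left _ _)
  have h1 : |x (a.succAbove b) - I.lower b| ≤ σ * D.meshSize i := by
    refine le_trans ?_ (hD.aspect i h.1 (a.succAbove b))
    have hlt := I.lower_lt_upper b
    have hxb := hx (a.succAbove b)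
    have hl1 := hl b ▸ le_max_left ((D.elem i).lower (a.succAbove b))
      ((D.elem j).lower (a.succAbove b))
    have hu1 := hu b ▸ min_le_left ((D.elem i).upper (a.succAbove b))
      ((D.elem j).upper (a.succAbove b))
    rw [abs_le]
    constructor <;> linarith [hxb.1, hxb.2]
  refine h1.trans ?_
  have h2 := hD.meshSize_pow_le_volume hσ h hplane hpre
  cases n with
  -- For `n = 0` the interface is a point without tangential coordinates.
  | zero => exact b.elim0
  | succ m =>
    have h3 := h2.trans (mul_le_mul_of_nonneg_left
      (volume_real_closedBox_le_edge_mul I hedge b) (by positivity))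
    refine le_of_mul_le_mul_left ?_ (pow_pos hh m)
    calc D.meshSize i ^ m * (σ * D.meshSize i) = σ * D.meshSize i ^ (m + 1) := by ring
      _ ≤ σ * (σ ^ (m + 1 + 1) * ((I.upper b - I.lower b) * (σ * D.meshSize i) ^ m)) :=
          mul_le_mul_of_nonneg_left h3 (by linarith)
      _ = _ := by rw [mul_pow]; ring

end

end ImmersedMesh

/-! ### Gradient transfer across one interface -/

namespace ImmersedMesh

variable {n k : ℕ} {σ : ℝ}

/-- The difference of the polynomial pieces of a spline on two adjacent elements is bounded by the
jump over their interface. -/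
theorem exists_sq_polyFun_sub_le_jump (n k : ℕ) {σ : ℝ} (hσ : 1 ≤ σ) :
    ∃ C > 0, ∀ (D : ImmersedMesh (n + 1)) (s : ℝ) (N : ℕ), D.IsRegular s σ N →
      ∀ u ∈ D.splineSpace k, ∀ P, D.IsPiecewise k u P → ∀ i j, D.Adjacent i j → ∀ x ∈ D.cell i,
        D.meshSize i ^ n * polyFun (P i - P j) x ^ 2 ≤ C * D.meshSize i ^ (2 * k) *
          ∫ x in D.interface i j, D.jump k u i j x ^ 2 ∂(surfaceMeasure (n + 1)) := by
  obtain ⟨C, hC, H⟩ := exists_sq_polyFun_le_integral_closedBox n k (σ ^ (2 * n + 1))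
  -- The factors come from the lower bound on the interface measure, from `|x_a - c| ≤ σ h_i` raised
  -- to the power `2k`, and from the pointwise bound for the jump polynomial.
  refine ⟨σ ^ (n + 1) * σ ^ (2 * k) * C, by positivity,
    fun D s N hD u hu P hP i j h x hx => ?_⟩
  obtain ⟨a, c, I, hc, hplane, hpre, hl, hup, hN⟩ := h.exists_box
  have hh := meshSize_pos (D := D) (i := i)
  set J := slice a c ((pderiv a)^[k] (P i - P j)) with hJ
  have hJmem : J ∈ restrictDegree (Fin n) ℝ k := slice_mem_restrictDegree a c
    (iterate_pderiv_mem_restrictDegree a k (Submodule.sub_mem _ (hP i h.1).1 (hP j h.2.1).1))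
  have hint : ∫ x in D.interface i j, D.jump k u i j x ^ 2 ∂(surfaceMeasure (n + 1)) =
      ∫ y in closedBox I, polyFun J y ^ 2 := by
    rw [setIntegral_surfaceMeasure_eq hplane, hpre]
    exact setIntegral_congr_fun (isClosed_closedBox I).measurableSet fun y hy => by
      simp only [hP.jump_hyperplaneEmb h.1 h.2.1 hpre hN hy, hJ]
  rw [hint, hP.polyFun_sub_eq hu h.1 h.2.1 hc hpre]
  set y : EuclideanSpace ℝ (Fin n) := WithLp.toLp 2 fun b => x (a.succAbove b) with hy
  have h1 := (H J hJmem I y fun b =>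
    hD.abs_sub_lower_interface_le hσ h hplane hpre hl hup hx b).1
  have h2 := hD.meshSize_pow_le_volume hσ h hplane hpre
  have h3 : ((x a - c) ^ k / k.factorial) ^ 2 ≤ (σ * D.meshSize i) ^ (2 * k) := by
    have hxc : |x a - c| ≤ σ * D.meshSize i := by
      refine le_trans ?_ (hD.aspect i h.1 a)
      have hxa := hx a
      have := (D.elem i).lower_lt_upper a
      rw [abs_le]
      rcases hc with ⟨e1, e2⟩ | ⟨e1, e2⟩ <;> constructor <;> linarith [hxa.1, hxa.2]
    have hk : (1 : ℝ) ≤ k.factorial := by exact_mod_cast k.factorial_pos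
    calc ((x a - c) ^ k / k.factorial) ^ 2 = (|x a - c| ^ k / k.factorial) ^ 2 := by
          rw [div_pow, div_pow, ← abs_pow, sq_abs]
      _ ≤ (|x a - c| ^ k) ^ 2 :=
          pow_le_pow_left₀ (by positivity) (div_le_self (by positivity) hk) 2
      _ = |x a - c| ^ (2 * k) := by rw [← pow_mul, mul_comm]
      _ ≤ _ := pow_le_pow_left₀ (abs_nonneg _) hxc _
  have hT : 0 ≤ ∫ y in closedBox I, polyFun J y ^ 2 := integral_nonneg fun _ => sq_nonneg _
  calc D.meshSize i ^ n * ((x a - c) ^ k / k.factorial * polyFun J y) ^ 2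
      = ((x a - c) ^ k / k.factorial) ^ 2 * (D.meshSize i ^ n * polyFun J y ^ 2) := by ring
    _ ≤ (σ * D.meshSize i) ^ (2 * k) *
        (σ ^ (n + 1) * volume.real (closedBox I) * polyFun J y ^ 2) :=
        mul_le_mul h3 (mul_le_mul_of_nonneg_right h2 (sq_nonneg _)) (by positivity) (by positivity)
    _ = (σ * D.meshSize i) ^ (2 * k) *
        (σ ^ (n + 1) * (volume.real (closedBox I) * polyFun J y ^ 2)) := by ring
    _ ≤ (σ * D.meshSize i) ^ (2 * k) *
        (σ ^ (n + 1) * (C * ∫ y in closedBox I, polyFun J y ^ 2)) := by gcongr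
    _ = _ := by rw [mul_pow]; ring

/-- The gradient on an element is bounded by the gradient on an adjacent element and the jump over
the interface. -/
theorem exists_gradient_le_adjacent (n : ℕ) (hk : 1 ≤ k) (hσ : 1 ≤ σ) :
    ∃ C₁ > 0, ∃ C₂ > 0, ∀ (D : ImmersedMesh (n + 1)) (s : ℝ) (N : ℕ), D.IsRegular s σ N →
      ∀ u ∈ D.splineSpace k, ∀ i j, D.Adjacent i j →
        ∫ x in D.cell i, ‖gradient u x‖ ^ 2 ≤ C₁ * (∫ x in D.cell j, ‖gradient u x‖ ^ 2) +
          C₂ * (D.interfaceSize i j ^ (2 * k - 1) *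
            ∫ x in D.interface i j, D.jump k u i j x ^ 2 ∂(surfaceMeasure (n + 1))) := by
  obtain ⟨A, hA, HA⟩ := exists_setIntegral_cell_le_adjacent n k hσ
  obtain ⟨B, hB, HB⟩ := exists_setIntegral_cell_pderiv_sq_le n k hσ
  obtain ⟨C, hC, HC⟩ := exists_sq_polyFun_sub_le_jump n k hσ
  -- The 2 comes from `p² ≤ 2q² + 2(p - q)²`, and `n + 1` counts the partial derivatives.
  refine ⟨2 * A, by positivity, 2 * ((n + 1) * (B * C)), by positivity,
    fun D s N hD u hu i j h => ?_⟩
  obtain ⟨P, hP⟩ := D.exists_isPiecewise hu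
  have hh := meshSize_pos (D := D) (i := i)
  set T := ∫ x in D.interface i j, D.jump k u i j x ^ 2 ∂(surfaceMeasure (n + 1)) with hT
  have hT0 : 0 ≤ T := integral_nonneg fun _ => sq_nonneg _
  have hw : P i - P j ∈ restrictDegree (Fin (n + 1)) ℝ k :=
    Submodule.sub_mem _ (hP i h.1).1 (hP j h.2.1).1
  have hdiff : ∀ b, ∫ x in D.cell i, polyFun (pderiv b (P i - P j)) x ^ 2 ≤
      B * C * (D.interfaceSize i j ^ (2 * k - 1) * T) := by
    intro b
    have h1 := HB D hD.toIsQuasiUniform i h.1 _ hw (C * D.meshSize i ^ (2 * k) * T /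
      D.meshSize i ^ n) (fun x hx => by
        rw [le_div_iff₀ (pow_pos hh n), mul_comm]
        exact HC D s N hD u hu P hP i j h x hx) b
    have h2 : ∫ x in D.cell i, polyFun (pderiv b (P i - P j)) x ^ 2 ≤
        B * C * (D.meshSize i ^ (2 * k - 1) * T) := by
      refine le_of_mul_le_mul_left (h1.trans_eq ?_) (pow_pos hh 2)
      -- The powers combine as `h^(n+1) h^(2k) / (h^n h^2) = h^(2k-1)`; `k ≥ 1` keeps the natural
      -- subtraction from truncating.
      obtain ⟨m, rfl⟩ : ∃ m, k = m + 1 := ⟨k - 1, by omega⟩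
      have e : 2 * (m + 1) - 1 = 2 * m + 1 := by omega
      rw [e]
      field_simp
      ring
    refine h2.trans ?_
    gcongr
    exact le_max_left _ _
  have hsplit : ∀ b, ∫ x in D.cell i, polyFun (pderiv b (P i)) x ^ 2 ≤
      2 * A * (∫ x in D.cell j, polyFun (pderiv b (P j)) x ^ 2) +
        2 * (B * C * (D.interfaceSize i j ^ (2 * k - 1) * T)) := by
    intro b
    have hc : ∀ p : MvPolynomial (Fin (n + 1)) ℝ,
        IntegrableOn (fun x => polyFun p x ^ 2) (D.cell i) := fun p =>
      integrableOn_cell_of_continuous ((continuous_polyFun p).pow 2)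
    have h1 : ∫ x in D.cell i, polyFun (pderiv b (P i)) x ^ 2 ≤
        ∫ x in D.cell i, (2 * polyFun (pderiv b (P j)) x ^ 2 +
          2 * polyFun (pderiv b (P i - P j)) x ^ 2) := by
      refine integral_mono (hc _) (((hc _).const_mul 2).add ((hc _).const_mul 2)) fun x => ?_
      simp only [map_sub, polyFun_sub]
      nlinarith [sq_nonneg (polyFun (pderiv b (P i)) x - 2 * polyFun (pderiv b (P j)) x)]
    rw [integral_add ((hc _).const_mul 2) ((hc _).const_mul 2), integral_const_mul,
      integral_const_mul] at h1
    have h2 := HA D hD.toIsQuasiUniform i j h _ (pderiv_mem_restrictDegree b (hP j h.2.1).1)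
    have h3 := hdiff b
    linarith
  rw [hP.setIntegral_cell_eq h.1, hP.setIntegral_cell_eq h.2.1]
  refine (Finset.sum_le_sum fun b _ => hsplit b).trans_eq ?_
  rw [Finset.sum_add_distrib, ← Finset.mul_sum]
  simp
  ring

end ImmersedMesh

/-! ### Propagation through the layers and the uniform ghost constants -/

namespace ImmersedMesh

variable {k : ℕ} {σ s : ℝ} {N : ℕ}

section

variable {d : ℕ} {D : ImmersedMesh d} {i j : Fin D.n} {u : EuclideanSpace ℝ (Fin d) → ℝ}

theorem IsQuasiUniform.mono {τ : ℝ} (hD : D.IsQuasiUniform σ) (h : σ ≤ τ) :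
    D.IsQuasiUniform τ where
  aspect i hi a := (hD.aspect i hi a).trans (mul_le_mul_of_nonneg_right h meshSize_pos.le)
  grading i j hij := (hD.grading i j hij).trans (mul_le_mul_of_nonneg_right h meshSize_pos.le)

theorem IsRegular.mono {τ : ℝ} (hD : D.IsRegular s σ N) (h : σ ≤ τ) : D.IsRegular s τ N where
  toIsQuasiUniform := hD.toIsQuasiUniform.mono h
  interface_large i j hij :=
    (hD.interface_large i j hij).trans (mul_le_mul_of_nonneg_right h measureReal_nonneg)
  face_bound := hD.face_bound
  layers := hD.layers

theorem Reachable.mono {m : ℕ} (h : D.Reachable 0 i) : D.Reachable m i := by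
  induction m with
  | zero => exact h
  | succ m ih => exact Or.inl ih

/-- A box is connected; missing the frontier, it cannot meet both the open set and the complement of
its closure. -/
theorem cell_subset_Ω (hi : i ∈ D.active) (hcut : ¬ D.IsCut i) : D.cell i ⊆ D.Ω := by
  have hne : (D.cell i ∩ D.Ω).Nonempty := by simpa [active] using hi
  refine (convex_closedBox (D.elem i)).isPreconnected.subset_left_of_subset_union D.isOpen_Ω
    isClosed_closure.isOpen_compl (Set.disjoint_compl_right_iff_subset.2 subset_closure)
    (fun x hx => ?_) hne
  by_contra hnot
  simp only [Set.mem_union, Set.mem_compl_iff, not_or, not_not] at hnot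
  exact hcut ⟨hi, x, hx, hnot.2, fun h => hnot.1 (interior_subset h)⟩

theorem gradTerm_le_sum_cell (hu : u ∈ D.splineSpace k) :
    D.gradTerm u ≤ ∑ i ∈ D.active, ∫ x in D.cell i, ‖gradient u x‖ ^ 2 := by
  have hae : (⋃ i ∈ D.active, interior (D.cell i) : Set _) =ᵐ[volume] D.region := by
    refine Filter.EventuallyLE.antisymm (Set.iUnion₂_mono fun i _ => interior_subset).eventuallyLE ?_
    have := (ae_restrict_iff' isCompact_region.isClosed.measurableSet).1
      (ae_mem_interior_cell (D := D))
    filter_upwards [this] with x hx hxr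
    obtain ⟨i, hi, hxi⟩ := hx hxr
    exact Set.mem_biUnion hi hxi
  rw [gradTerm, ← setIntegral_congr_set hae, integral_biUnion_finset D.active
    (s := fun i => interior (D.cell i)) (fun i _ => isOpen_interior.measurableSet) (fun i _ j _ hij => D.disjoint_elem i j hij)
    fun i hi => (integrableOn_gradient_sq hu).mono_set
      (interior_subset.trans (cell_subset_region hi))]
  exact Finset.sum_le_sum fun i _ => (setIntegral_interior_cell _).le

/-- The scaled squared jump over an interface. -/
noncomputable def jumpTerm (D : ImmersedMesh d) (k : ℕ) (u : EuclideanSpace ℝ (Fin d) → ℝ)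
    (i j : Fin D.n) : ℝ :=
  D.interfaceSize i j ^ (2 * k - 1) *
    ∫ x in D.interface i j, D.jump k u i j x ^ 2 ∂(surfaceMeasure d)

theorem jumpTerm_nonneg : 0 ≤ D.jumpTerm k u i j :=
  mul_nonneg (pow_nonneg interfaceSize_pos.le _) (integral_nonneg fun _ => sq_nonneg _)

theorem jumpTerm_comm : D.jumpTerm k u i j = D.jumpTerm k u j i := by
  rw [jumpTerm, jumpTerm, interfaceSize_comm, interface_comm]
  simp only [jump_sq_comm k u i j]

/-- The ghost mesh lists each pair once, in increasing order, while ordered pairs may meet it in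
both orientations; hence the factor 2. -/
theorem sum_jumpTerm_le {E : Finset (Fin D.n × Fin D.n)}
    (hE : ∀ p ∈ E, D.Adjacent p.1 p.2 ∧ D.IsCut p.1) :
    ∑ p ∈ E, D.jumpTerm k u p.1 p.2 ≤ 2 * ∑ p ∈ D.ghost, D.jumpTerm k u p.1 p.2 := by
  classical
  rw [← Finset.sum_filter_add_sum_filter_not E fun p => p.1 < p.2, two_mul]
  refine add_le_add ?_ ?_
  · refine Finset.sum_le_sum_of_subset_of_nonneg (fun p hp => ?_) fun p _ _ => jumpTerm_nonneg
    obtain ⟨hp, hlt⟩ := Finset.mem_filter.1 hp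
    obtain ⟨h, hcut⟩ := hE p hp
    exact mem_ghost.2 ⟨⟨h.1, h.2.1⟩, hlt, Or.inl hcut⟩
  · have hswap := Finset.sum_image (s := E.filter fun p => ¬ p.1 < p.2) (g := Prod.swap)
      (f := fun p => D.jumpTerm k u p.1 p.2) Prod.swap_injective.injOn
    refine (Finset.sum_congr rfl fun p _ => jumpTerm_comm).trans_le (hswap.symm.trans_le ?_)
    refine Finset.sum_le_sum_of_subset_of_nonneg (fun p hp => ?_) fun p _ _ => jumpTerm_nonneg
    obtain ⟨q, hq, rfl⟩ := Finset.mem_image.1 hp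
    obtain ⟨hq, hlt⟩ := Finset.mem_filter.1 hq
    obtain ⟨h, hcut⟩ := hE q hq
    exact mem_ghost.2 ⟨⟨h.2.1, h.1⟩, lt_of_le_of_ne (not_lt.1 hlt) h.2.2.1.symm, Or.inr hcut⟩

end

variable {n : ℕ}

open Classical in
/-- The number of elements adjacent to a given one is bounded. -/
theorem exists_card_adjacent_le (n : ℕ) (hσ : 1 ≤ σ) :
    ∃ M > (0 : ℝ), ∀ D : ImmersedMesh (n + 1), D.IsQuasiUniform σ → ∀ j,
      ((Finset.univ.filter fun i => D.Adjacent i j).card : ℝ) ≤ M := by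
  set R := (σ ^ 2 + σ) * σ ^ n with hR
  have hR0 : 0 < R := by positivity
  refine ⟨σ ^ (n + 1) * (2 * R) ^ (n + 1), by positivity, fun D hD j => ?_⟩
  have hv : 0 < volume.real (D.cell j) := volume_real_closedBox_pos _
  -- A box centred at the lower corner of element `j` that contains all its neighbours. Their
  -- interiors are disjoint and their volumes comparable to that of `j`, so a volume count bounds
  -- their number.
  let B : BoxIntegral.Box (Fin (n + 1)) :=
    ⟨fun b => (D.elem j).lower b - R * ((D.elem j).upper b - (D.elem j).lower b),
      fun b => (D.elem j).lower b + R * ((D.elem j).upper b - (D.elem j).lower b), fun b => by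
        have := mul_pos hR0 (sub_pos.2 ((D.elem j).lower_lt_upper b))
        linarith⟩
  have hB : volume.real (closedBox B) = (2 * R) ^ (n + 1) * volume.real (D.cell j) := by
    rw [cell, volume_real_closedBox, volume_real_closedBox]
    have : ∀ b, B.upper b - B.lower b =
        2 * R * ((D.elem j).upper b - (D.elem j).lower b) := fun b => by
      simp only [B]; ring
    simp only [this, Finset.prod_mul_distrib, Finset.prod_const, Finset.card_univ,
      Fintype.card_fin, mul_pow]
  have h1 := sum_setIntegral_cell_le (D := D) (s := Finset.univ.filter fun i => D.Adjacent i j)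
    (T := closedBox B) (f := fun _ => 1)
    (integrableOn_const (isCompact_closedBox B).measure_lt_top.ne) (fun _ => zero_le_one)
    fun i hi x hx => by
      have h := (Finset.mem_filter.1 hi).2
      intro b
      have := abs_le.1 (h.abs_sub_lower_le hσ hD (interior_subset hx) b)
      constructor <;> simp only [B] <;> linarith [this.1, this.2]
  simp only [setIntegral_const, smul_eq_mul, mul_one] at h1
  have h2 : ((Finset.univ.filter fun i => D.Adjacent i j).card : ℝ) * volume.real (D.cell j) ≤
      σ ^ (n + 1) * ∑ i ∈ Finset.univ.filter (fun i => D.Adjacent i j), volume.real (D.cell i) := by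
    rw [Finset.mul_sum, ← nsmul_eq_mul, ← Finset.sum_const]
    exact Finset.sum_le_sum fun i hi => (Finset.mem_filter.1 hi).2.symm.volume_le hD
  refine le_of_mul_le_mul_right (h2.trans ?_) hv
  rw [mul_assoc, ← hB]
  exact mul_le_mul_of_nonneg_left h1 (by positivity)

open Classical in
/-- The elements that can be reached through at most `m` interfaces. -/
noncomputable def layer (D : ImmersedMesh (n + 1)) (m : ℕ) : Finset (Fin D.n) :=
  Finset.univ.filter fun i => D.Reachable m i

theorem mem_layer {D : ImmersedMesh (n + 1)} {m : ℕ} {i : Fin D.n} :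
    i ∈ D.layer m ↔ D.Reachable m i := by simp [layer]

/-- Induction on layers: uncut elements lie in the domain, and each new element is charged to
adjacent elements already reached, each of which is charged a bounded number of times. -/
theorem exists_sum_layer_le (n : ℕ) (hk : 1 ≤ k) (hσ : 1 ≤ σ) (m : ℕ) :
    ∃ A > 0, ∃ B > 0, ∀ (D : ImmersedMesh (n + 1)) (s : ℝ) (N : ℕ), D.IsRegular s σ N →
      ∀ u ∈ D.splineSpace k,
        ∑ i ∈ D.layer m, ∫ x in D.cell i, ‖gradient u x‖ ^ 2 ≤
          A * D.physTerm u + B * ∑ p ∈ D.ghost, D.jumpTerm k u p.1 p.2 := by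
  classical
  induction m with
  | zero =>
    refine ⟨1, one_pos, 1, one_pos, fun D s N hD u hu => ?_⟩
    have h0 : 0 ≤ ∑ p ∈ D.ghost, D.jumpTerm k u p.1 p.2 :=
      Finset.sum_nonneg fun _ _ => jumpTerm_nonneg
    rw [one_mul, one_mul]
    refine le_add_of_le_of_nonneg ?_ h0
    refine sum_setIntegral_cell_le ((integrableOn_gradient_sq hu).mono_set Ω_subset_region)
      (fun _ => sq_nonneg _) fun i hi => ?_
    have h := mem_layer.1 hi
    exact interior_subset.trans (cell_subset_Ω h.1 h.2)
  | succ m ih =>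
    obtain ⟨A, hA, B, hB, ih⟩ := ih
    obtain ⟨C₁, hC₁, C₂, hC₂, H⟩ := exists_gradient_le_adjacent n hk hσ
    obtain ⟨M, hM, HM⟩ := exists_card_adjacent_le n hσ
    refine ⟨(1 + C₁ * M) * A, by positivity, (1 + C₁ * M) * B + C₂ * 2, by positivity,
      fun D s N hD u hu => ?_⟩
    have ih := ih D s N hD u hu
    set G : Fin D.n → ℝ := fun i => ∫ x in D.cell i, ‖gradient u x‖ ^ 2 with hG
    have hG0 : ∀ i, 0 ≤ G i := fun i => integral_nonneg fun _ => sq_nonneg _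
    -- All adjacent pairs are kept rather than one predecessor chosen; the surplus terms are
    -- nonnegative.
    set E := ((D.layer (m + 1) \ D.layer m) ×ˢ D.layer m).filter fun p => D.Adjacent p.1 p.2
      with hE
    have hsub : D.layer m ⊆ D.layer (m + 1) := fun i hi =>
      mem_layer.2 (Or.inl (mem_layer.1 hi))
    have hnew : ∑ i ∈ D.layer (m + 1) \ D.layer m, G i ≤
        ∑ p ∈ E, (C₁ * G p.2 + C₂ * D.jumpTerm k u p.1 p.2) := by
      rw [hE, Finset.sum_filter, Finset.sum_product]
      refine Finset.sum_le_sum fun i hi => ?_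
      obtain ⟨hi1, hi2⟩ := Finset.mem_sdiff.1 hi
      obtain h | ⟨j, hj, hij⟩ := mem_layer.1 hi1
      · exact absurd (mem_layer.2 h) hi2
      refine (H D s N hD u hu i j hij).trans ?_
      refine (if_pos hij).ge.trans (Finset.single_le_sum (f := fun j => if D.Adjacent i j then
        C₁ * G j + C₂ * D.jumpTerm k u i j else 0) (fun j _ => ?_) (mem_layer.2 hj))
      split_ifs
      · exact add_nonneg (mul_nonneg hC₁.le (hG0 j)) (mul_nonneg hC₂.le jumpTerm_nonneg)
      · exact le_rfl
    have hjump : ∑ p ∈ E, D.jumpTerm k u p.1 p.2 ≤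
        2 * ∑ p ∈ D.ghost, D.jumpTerm k u p.1 p.2 := by
      refine sum_jumpTerm_le fun p hp => ?_
      obtain ⟨hp, hadj⟩ := Finset.mem_filter.1 hp
      refine ⟨hadj, ?_⟩
      -- A new element must be cut, since an uncut one belongs to layer zero; so its interfaces lie
      -- in the ghost mesh.
      by_contra hcut
      exact (Finset.mem_sdiff.1 (Finset.mem_product.1 hp).1).2
        (mem_layer.2 (Reachable.mono ⟨hadj.1, hcut⟩))
    have hcard : ∑ p ∈ E, G p.2 ≤ M * ∑ j ∈ D.layer m, G j := by
      rw [hE, Finset.sum_filter, Finset.sum_product_right, Finset.mul_sum]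
      refine Finset.sum_le_sum fun j _ => ?_
      rw [← Finset.sum_filter]
      change ∑ _i ∈ (D.layer (m + 1) \ D.layer m).filter fun i => D.Adjacent i j, G j ≤ _
      rw [Finset.sum_const, nsmul_eq_mul]
      refine mul_le_mul_of_nonneg_right (le_trans ?_ (HM D hD.toIsQuasiUniform j)) (hG0 j)
      exact_mod_cast Finset.card_le_card
        (Finset.filter_subset_filter _ (Finset.subset_univ _))
    rw [Finset.sum_add_distrib, ← Finset.mul_sum, ← Finset.mul_sum] at hnew
    rw [← Finset.sum_sdiff hsub]
    have h1 := mul_le_mul_of_nonneg_left hcard hC₁.le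
    have h2 := mul_le_mul_of_nonneg_left hjump hC₂.le
    have h3 := mul_le_mul_of_nonneg_left ih (by positivity : 0 ≤ 1 + C₁ * M)
    linarith

/-- The ghost constants depend only on the dimension, the degree and the regularity of the mesh. -/
theorem exists_isGhostConst (n : ℕ) (hk : 1 ≤ k) (σ : ℝ) (N : ℕ) :
    ∃ CG > 0, ∃ CF > 0, ∀ (D : ImmersedMesh (n + 1)) (s : ℝ), D.IsRegular s σ N →
      D.IsGhostConst k CG CF := by
  -- The estimates assume `1 ≤ σ`; enlarging `σ` only weakens regularity.
  obtain ⟨A, hA, B, hB, H⟩ := exists_sum_layer_le n hk (le_max_right σ 1) N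
  refine ⟨A, hA, B, hB, fun D s hD u hu => ?_⟩
  have h1 := H D s N (hD.mono (le_max_left _ _)) u hu
  have h2 : ∑ i ∈ D.active, ∫ x in D.cell i, ‖gradient u x‖ ^ 2 ≤
      ∑ i ∈ D.layer N, ∫ x in D.cell i, ‖gradient u x‖ ^ 2 :=
    Finset.sum_le_sum_of_subset_of_nonneg (fun i hi => mem_layer.2 (hD.layers i hi))
      fun i _ _ => integral_nonneg fun _ => sq_nonneg _
  refine (gradTerm_le_sum_cell hu).trans (h2.trans (h1.trans_eq ?_))
  rw [Finset.mul_sum]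
  simp only [jumpTerm, mul_assoc]
  rfl

theorem IsGhostConst.mono {d : ℕ} {D : ImmersedMesh d} {CG CF CG' CF' : ℝ}
    (h : D.IsGhostConst k CG CF) (hG : CG ≤ CG') (hF : CF ≤ CF') : D.IsGhostConst k CG' CF' := by
  refine fun u hu => (h u hu).trans (add_le_add (mul_le_mul_of_nonneg_right hG physTerm_nonneg)
    (Finset.sum_le_sum fun p _ => ?_))
  exact mul_le_mul_of_nonneg_right (mul_le_mul_of_nonneg_right hF
    (pow_nonneg interfaceSize_pos.le _)) (integral_nonneg fun _ => sq_nonneg _)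

end ImmersedMesh
-- The theorem
theorem mainTheorem1 (d k : ℕ) (hd : 1 ≤ d) (hk : 1 ≤ k) :
    -- continuity with constant 5
    (∀ (D : ImmersedMesh d) (βt : Fin D.n → ℝ) (γt : Fin D.n → Fin D.n → ℝ),
      (∀ i, 0 < βt i) → (∀ i j, 0 ≤ γt i j) →
      ∀ u ∈ D.splineSpace k, ∀ v ∈ D.splineSpace k,
        D.form k βt γt u v ≤ 5 * D.energyNorm k βt γt u * D.energyNorm k βt γt v) ∧
    -- the trace and ghost constants exist uniformly, and the thresholds imply uniform coercivity
    (∀ s : ℝ, ∃ CT > 0, ∀ (σ : ℝ) (N : ℕ), ∃ CG > 0, ∃ CF > 0,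
      (∀ D : ImmersedMesh d, D.IsRegular s σ N → D.IsTraceConst k CT ∧ D.IsGhostConst k CG CF) ∧
      ∀ β γ : ℝ, CT * CG ≤ β → CF / CG ≤ γ →
        ∃ c > 0, ∀ D : ImmersedMesh d, D.IsRegular s σ N → ∀ u ∈ D.splineSpace k,
          c * D.energyNorm k (D.nitscheParam β) (D.ghostParam k γ) u ^ 2 ≤
            D.form k (D.nitscheParam β) (D.ghostParam k γ) u u) ∧
    -- uniform coercivity for arbitrary trace and ghost constants
    (∀ σ CT CG CF β γ : ℝ, 0 < CT → 0 < CG → 0 < CF → CT * CG < β → CF / CG ≤ γ →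
      ∃ c > 0, ∀ D : ImmersedMesh d, D.IsQuasiUniform σ →
        D.IsTraceConst k CT → D.IsGhostConst k CG CF → ∀ u ∈ D.splineSpace k,
          c * D.energyNorm k (D.nitscheParam β) (D.ghostParam k γ) u ^ 2 ≤
            D.form k (D.nitscheParam β) (D.ghostParam k γ) u u) := by
  refine ⟨fun D βt γt hβ hγ u hu v hv => ImmersedMesh.form_le hd hβ hγ hu hv, fun s => ?_, ?_⟩
  · obtain ⟨n, rfl⟩ : ∃ n, d = n + 1 := ⟨d - 1, by omega⟩
    obtain ⟨CT, hCT, HT⟩ := ImmersedMesh.exists_isTraceConst hd k s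
    refine ⟨CT, hCT, fun σ N => ?_⟩
    obtain ⟨A, hA, B, hB, HG⟩ := ImmersedMesh.exists_isGhostConst n hk σ N
    -- Doubling both ghost constants leaves their ratio unchanged and turns the non-strict threshold
    -- for `β` into the strict one `CT * A < β`, so coercivity applies with the undoubled constants.
    refine ⟨2 * A, by positivity, 2 * B, by positivity, fun D hD =>
      ⟨HT D hD.face_bound, (HG D s hD).mono (by linarith) (by linarith)⟩, fun β γ hβ hγ => ?_⟩
    rw [mul_div_mul_left _ _ two_ne_zero] at hγ
    have hβ' : CT * A < β := by
      have := mul_pos hCT hA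
      linarith
    obtain ⟨c, hc, H⟩ := ImmersedMesh.exists_coercive (d := n + 1) (k := k) hCT hA hB hβ' hγ
    exact ⟨c, hc, fun D hD => H D (HT D hD.face_bound) (HG D s hD)⟩
  · intro σ CT CG CF β γ hCT hCG hCF hβ hγ
    obtain ⟨c, hc, H⟩ := ImmersedMesh.exists_coercive (d := d) (k := k) hCT hCG hCF hβ hγ
    exact ⟨c, hc, fun D _ => H D⟩
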